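/- \textbf{Setting.} Let $r\ge 1$ and let $M$ be a domain with global coordinates $w^0,\dots,w^{r-1}$, i.e. an open subset of $\mathbb R^r$, on which $w^0>0$. Put $w^r=1$ and $w^k=0$ for $k<0$ or $k>r$. Let $\mathcal A$ be the completion, with respect to the degree $\deg w^{i,s}=s$, of the ring $C^\infty(M)[w^{i,s}: 0\le i<r,\ s\ge1]$ of differential polynomials, where $w^{i,s}=\partial_x^sw^i$; let $\Lambda_x=\mathcal A/\partial_x\mathcal A$ be the space of local functionals $F=\int f\,dx$, with $\frac{\delta F}{\delta w^i}=\sum_{s\ge0}(-\partial_x)^s\frac{\partial f}{\partial w^{i,s}}$, and let $\hat\Gamma^p_x$ be the space of alternating $p$-linear maps $\Lambda_x^p\to\Lambda_x$. \textbf{The structures $P_m$.} For parameters $(a_0,\dots,a_r)\in\mathbb R^{r+1}$ ($a_k=0$ for $k<0$ or $k>r$) let $\mathcal D_k=2w^k\partial_x+w^k_x-\frac{\epsilon^2}{2}a_k\partial_x^3$, and let $P_m\in\hat\Gamma_x^2$, $m=0,1,\dots,r+2$, be given by $$P_m(F,G)=\int\sum_{i,j=0}^{r-1}\frac{\delta F}{\delta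 w^i}\,P_m^{ij}\Big(\frac{\delta G}{\delta w^j}\Big)dx,$$ where $P_m^{ij}=f_m^{ij}\,\mathcal D_{i+j+1-m}$ for $0\le m\le r$, with $f_m^{ij}=1$ if $i,j<m$, $f_m^{ij}=-1$ if $i,j\ge m$ and $f_m^{ij}=0$ otherwise, and $$P_{r+1}^{ij}=\mathcal D_{i+j-r}-\mathcal D_i\mathcal D_r^{-1}\mathcal D_j,\qquad P_{r+2}^{ij}=\mathcal D_{i+j-r-1}-\mathcal D_{i-1}\mathcal D_r^{-1}\mathcal D_j-\mathcal D_i\mathcal D_r^{-1}\mathcal D_{j-1}+\mathcal D_i\mathcal D_r^{-1}\mathcal D_{r-1}\mathcal D_r^{-1}\mathcal D_j .$$ The nonlocal terms are defined as follows. One has $\sum_i w^i_x\frac{\delta F}{\delta w^i}=\partial_xW(F)$, where $W(F)=f-\sum_{i}\sum_{a,b\ge0}w^{i,a+1}(-\partial_x)^b\frac{\partial f}{\partial w^{i,a+b+1}}$ depends only on $F=\int f\,dx$. This $W(F)$ is taken as $\partial_x^{-1}\big(\sum_iw^i_x\frac{\delta F}{\delta w^i}\big)$, so that $$S(G):=\sum_j\mathcal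 D_r^{-1}\mathcal D_j\Big(\frac{\delta G}{\delta w^j}\Big)=\frac12\Big(1-\frac{\epsilon^2a_r}{4}\partial_x^2\Big)^{-1}\Big(\sum_j\Big(2w^j\frac{\delta G}{\delta w^j}-\frac{\epsilon^2}{2}a_j\,\partial_x^2\frac{\delta G}{\delta w^j}\Big)-W(G)\Big),$$ and, the $\mathcal D_k$ being skew-adjoint, $\int\sum_i\frac{\delta F}{\delta w^i}\,\mathcal D_i\mathcal D_r^{-1}(Y)\,dx:=\int S(F)\,Y\,dx$. The leading term $P_m^{[0]}$ is the value of $P_m$ at $\epsilon=0$. \textbf{The reciprocal transformation.} For an invertible $\rho\in\mathcal A$ put $\partial_y=\rho^{-1}\partial_x$, $\Lambda_y=\mathcal A/\partial_y\mathcal A$, and let $\hat\Gamma^p_y$ be the space of alternating $p$-linear maps $\Lambda_y^p\to\Lambda_y$. Let $\Phi_0:\Lambda_x\to\Lambda_y$ be the isomorphism $f+\partial_x\mathcal A\mapsto\rho^{-1}f+\partial_y\mathcal A$, and $$\Phi_p:\hat\Gamma^p_x\to\hat\Gamma^p_y,\qquad \Phi_p(Q)(Y_1,\dots,Y_p)=\Phi_0\big(Q(\Phi_0^{-1}Y_1,\dots,\Phi_0^{-1}Y_p)\big).$$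 At the dispersionless level take $\rho=\sqrt{w^0}$, and let $v^i=w^{r-i}/w^0$ $(0\le i\le r-1)$, which are again coordinates on $M$. Rewriting densities $f(v,v_y,v_{yy},\dots)$ in terms of $w,w_x,w_{xx},\dots$ by means of $v^{i,s}=\partial_y^sv^i$ identifies the space of local functionals $\int f(v,v_y,\dots)\,dy$ with $\Lambda_y$; by this identification let $\tilde P_m\in\hat\Gamma_y^2$ be the structure given by the above formulas with $x$, $w^i$, $(a_0,\dots,a_r)$ replaced by $y$, $v^i$, $(a_r,\dots,a_0)$. \textbf{Theorem.} The identification above is bijective, and for $m=0,1,\dots,r+1,r+2$ $$\Phi_2\big(P_m^{[0]}\big)=-\tilde P_{r+2-m}^{[0]} .$$ -/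

import Mathlib

open scoped ContDiff
open TopologicalSpace

noncomputable section

namespace RKdVCH

/-! ### Smooth functions on a coordinate domain -/

/-- The values `w^k`, `k ∈ ℤ`, at a point `p = (w^0, …, w^{r-1})`, with the convention
`w^r = 1` and `w^k = 0` for `k < 0` or `k > r`. -/
def coord {r : ℕ} (p : Fin r → ℝ) (k : ℤ) : ℝ :=
  if h : 0 ≤ k ∧ k < r then p ⟨k.toNat, by omega⟩ else if k = r then 1 else 0

variable {r : ℕ} {U V : Opens (Fin r → ℝ)}

open Classical in
/-- Extension by zero. Only its germs at points of `U` are ever used. -/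
def zeroExt (f : U → ℝ) : (Fin r → ℝ) → ℝ := fun x => if h : x ∈ U then f ⟨x, h⟩ else 0

lemma zeroExt_of_mem (f : U → ℝ) {x : Fin r → ℝ} (h : x ∈ U) : zeroExt f x = f ⟨x, h⟩ :=
  dif_pos h

lemma zeroExt_coe (f : U → ℝ) (p : U) : zeroExt f p = f p := dif_pos p.2

/-- The algebra of smooth functions on `U`. -/
def smoothFun (U : Opens (Fin r → ℝ)) : Subalgebra ℝ (U → ℝ) where
  carrier := {f | ContDiffOn ℝ ∞ (zeroExt f) U}
  mul_mem' {f g} hf hg := (ContDiffOn.mul hf hg).congr fun x hx => by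
    simp [zeroExt_of_mem _ (show x ∈ U from hx)]
  add_mem' {f g} hf hg := (ContDiffOn.add hf hg).congr fun x hx => by
    simp [zeroExt_of_mem _ (show x ∈ U from hx)]
  algebraMap_mem' c := (contDiffOn_const (c := c)).congr fun x hx => by
    simp [zeroExt_of_mem _ (show x ∈ U from hx)]

/-- `C^∞(U)`. -/
def Sm (U : Opens (Fin r → ℝ)) : Type := smoothFun U

instance : CommRing (Sm U) := inferInstanceAs (CommRing (smoothFun U))

instance : Algebra ℝ (Sm U) := inferInstanceAs (Algebra ℝ (smoothFun U))

/-- The value of `f ∈ C^∞(U)` at `p`. -/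
def Sm.val (f : Sm U) : U → ℝ := Subtype.val (show smoothFun U from f)

lemma Sm.ext {f g : Sm U} (h : ∀ p, f.val p = g.val p) : f = g := Subtype.ext (funext h)

lemma Sm.val_add (f g : Sm U) : (f + g).val = f.val + g.val := rfl

lemma Sm.val_mul (f g : Sm U) : (f * g).val = f.val * g.val := rfl

lemma Sm.val_one : (1 : Sm U).val = 1 := rfl

lemma Sm.val_smul (c : ℝ) (f : Sm U) : (c • f).val = c • f.val := rfl

lemma zeroExt_add (f g : U → ℝ) : zeroExt (f + g) = zeroExt f + zeroExt g := by
  ext x; by_cases h : x ∈ U <;> simp [zeroExt, h]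

lemma zeroExt_mul (f g : U → ℝ) : zeroExt (f * g) = zeroExt f * zeroExt g := by
  ext x; by_cases h : x ∈ U <;> simp [zeroExt, h]

lemma zeroExt_smul (c : ℝ) (f : U → ℝ) : zeroExt (c • f) = c • zeroExt f := by
  ext x; by_cases h : x ∈ U <;> simp [zeroExt, h]

lemma zeroExt_one (p : U) : zeroExt (1 : U → ℝ) =ᶠ[nhds (p : Fin r → ℝ)] fun _ => (1 : ℝ) := by
  filter_upwards [U.isOpen.mem_nhds p.2] with x hx
  simp [zeroExt_of_mem _ (show x ∈ U from hx)]

lemma contDiffOn_zeroExt (f : Sm U) : ContDiffOn ℝ ∞ (zeroExt f.val) U :=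
  (show smoothFun U from f).2

lemma differentiableAt_zeroExt (f : Sm U) (p : U) : DifferentiableAt ℝ (zeroExt f.val) p :=
  ((contDiffOn_zeroExt f).contDiffAt (U.isOpen.mem_nhds p.2)).differentiableAt (by simp)

/-- The restriction to `U` of a function that is smooth on `U`. -/
def Sm.ofFun (g : (Fin r → ℝ) → ℝ) (hg : ContDiffOn ℝ ∞ g U) : Sm U :=
  (⟨fun p => g p, hg.congr fun x hx => by simp [zeroExt_of_mem _ (show x ∈ U from hx)]⟩ :
    smoothFun U)

lemma Sm.val_ofFun (g : (Fin r → ℝ) → ℝ) (hg : ContDiffOn ℝ ∞ g U) (p : U) :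
    (Sm.ofFun g hg).val p = g p := rfl

lemma zeroExt_ofFun_eventuallyEq (g : (Fin r → ℝ) → ℝ) (hg : ContDiffOn ℝ ∞ g U) (p : U) :
    zeroExt (Sm.ofFun g hg).val =ᶠ[nhds (p : Fin r → ℝ)] g := by
  filter_upwards [U.isOpen.mem_nhds p.2] with x hx
  rw [zeroExt_of_mem _ (show x ∈ U from hx), Sm.val_ofFun]

/-- The partial derivative `∂/∂w^i` on `C^∞(U)`. -/
def pd (i : Fin r) : Derivation ℝ (Sm U) (Sm U) where
  toFun f := Sm.ofFun (fun x => fderiv ℝ (zeroExt f.val) x (Pi.single i 1))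
    (((contDiffOn_zeroExt f).fderiv_of_isOpen U.isOpen (by simp)).clm_apply contDiffOn_const)
  map_add' f g := by
    refine Sm.ext fun p => ?_
    simp [Sm.val_ofFun, zeroExt_add, Sm.val_add,
      fderiv_add (differentiableAt_zeroExt f p) (differentiableAt_zeroExt g p)]
  map_smul' c f := by
    refine Sm.ext fun p => ?_
    simp [Sm.val_ofFun, zeroExt_smul, Sm.val_smul, fderiv_const_smul (differentiableAt_zeroExt f p)]
  map_one_eq_zero' := by
    refine Sm.ext fun p => ?_
    simp only [LinearMap.coe_mk, AddHom.coe_mk, Sm.val_ofFun, Sm.val_one, (zeroExt_one p).fderiv_eq]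
    simp
    rfl
  leibniz' f g := by
    refine Sm.ext fun p => ?_
    simp [Sm.val_ofFun, zeroExt_mul, Sm.val_mul, Sm.val_add,
      fderiv_mul (differentiableAt_zeroExt f p) (differentiableAt_zeroExt g p), zeroExt_coe]

lemma pd_apply (i : Fin r) (f : Sm U) (p : U) :
    (pd i f).val p = fderiv ℝ (zeroExt f.val) p (Pi.single i 1) := rfl

lemma pd_comm (i j : Fin r) (f : Sm U) : pd i (pd j f) = pd j (pd i f) := by
  have key : ∀ (a b : Fin r) (p : U), (pd a (pd b f)).val p =
      fderiv ℝ (fderiv ℝ (zeroExt f.val)) p (Pi.single a 1) (Pi.single b 1) := by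
    intro a b p
    have hf := (contDiffOn_zeroExt f).contDiffAt (U.isOpen.mem_nhds p.2)
    have hd : DifferentiableAt ℝ (fderiv ℝ (zeroExt f.val)) p :=
      (hf.fderiv_right (m := ∞) (by simp)).differentiableAt (by simp)
    rw [pd_apply]
    refine (congrArg (fun L : (Fin r → ℝ) →L[ℝ] ℝ => L (Pi.single a 1))
      (zeroExt_ofFun_eventuallyEq (U := U) _ _ p).fderiv_eq).trans ?_
    rw [fderiv_clm_apply hd (differentiableAt_const _)]
    simp
  refine Sm.ext fun p => ?_
  rw [key, key]
  refine (((contDiffOn_zeroExt f).contDiffAt (U.isOpen.mem_nhds p.2)).isSymmSndFDerivAt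
    ?_) _ _
  rw [minSmoothness_of_isRCLikeNormedField]
  exact WithTop.coe_le_coe.2 le_top

lemma contDiff_coord (k : ℤ) : ContDiff ℝ ∞ fun p : Fin r → ℝ => coord p k := by
  unfold coord
  split_ifs
  · exact contDiff_apply ℝ ℝ _
  · exact contDiff_const
  · exact contDiff_const

/-- `w^k` as an element of `C^∞(U)`, for `k ∈ ℤ`. -/
def wSm (U : Opens (Fin r → ℝ)) (k : ℤ) : Sm U := Sm.ofFun (coord · k) (contDiff_coord k).contDiffOn

/-! ### Differential polynomials -/

/-- Differential polynomials: polynomials over `C^∞(U)` in the jet variables; the variable with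
index `(i, s)` is `w^{i,s+1} = ∂_x^{s+1} w^i`. -/
abbrev DP (U : Opens (Fin r → ℝ)) := MvPolynomial (Fin r × ℕ) (Sm U)

/-- `deg w^{i,s} = s`. -/
def wt : Fin r × ℕ → ℕ := fun v => v.2 + 1

/-- Homogeneous differential polynomials of degree `d`. -/
abbrev Hom (d : ℕ) (f : DP U) : Prop := MvPolynomial.IsWeightedHomogeneous wt f d

/-- A derivation of the coefficient ring, applied to all coefficients of a polynomial. -/
def coeffDer {σ R : Type*} [CommRing R] [Algebra ℝ R] (d : Derivation ℝ R R) :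
    Derivation ℝ (MvPolynomial σ R) (MvPolynomial σ R) :=
  have key : ∀ (f : MvPolynomial σ R) (n : σ →₀ ℕ),
      (∑ k ∈ f.support, MvPolynomial.monomial k (d (f.coeff k))).coeff n = d (f.coeff n) := by
    classical
    intro f n
    simp only [MvPolynomial.coeff_sum, MvPolynomial.coeff_monomial, Finset.sum_ite_eq']
    split_ifs with h
    · rfl
    · rw [MvPolynomial.notMem_support_iff.1 h, map_zero]
  Derivation.mk'
    { toFun := fun f => ∑ n ∈ f.support, MvPolynomial.monomial n (d (f.coeff n))
      map_add' := fun f g => by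
        ext n; rw [MvPolynomial.coeff_add, key, key, key, MvPolynomial.coeff_add, map_add]
      map_smul' := fun c f => by
        ext n
        rw [RingHom.id_apply, MvPolynomial.coeff_smul, key, key, MvPolynomial.coeff_smul,
          d.map_smul] }
    fun f g => by
      classical
      ext n
      simp only [LinearMap.coe_mk, AddHom.coe_mk, smul_eq_mul, MvPolynomial.coeff_add]
      rw [key, MvPolynomial.coeff_mul, MvPolynomial.coeff_mul, mul_comm g,
        MvPolynomial.coeff_mul, map_sum, ← Finset.sum_add_distrib]
      refine Finset.sum_congr rfl fun x _ => ?_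
      rw [key, key, d.leibniz, smul_eq_mul, smul_eq_mul]
      ring

lemma coeff_coeffDer {σ R : Type*} [CommRing R] [Algebra ℝ R] (d : Derivation ℝ R R)
    (f : MvPolynomial σ R) (n : σ →₀ ℕ) : (coeffDer d f).coeff n = d (f.coeff n) := by
  classical
  change (∑ k ∈ f.support, MvPolynomial.monomial k (d (f.coeff k))).coeff n = d (f.coeff n)
  simp only [MvPolynomial.coeff_sum, MvPolynomial.coeff_monomial, Finset.sum_ite_eq']
  split_ifs with h
  · rfl
  · rw [MvPolynomial.notMem_support_iff.1 h, map_zero]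

lemma coeffDer_C {σ R : Type*} [CommRing R] [Algebra ℝ R] (d : Derivation ℝ R R) (c : R) :
    coeffDer d (MvPolynomial.C c : MvPolynomial σ R) = MvPolynomial.C (d c) := by
  classical
  ext n
  rw [coeff_coeffDer, MvPolynomial.coeff_C, MvPolynomial.coeff_C]
  split_ifs <;> simp

lemma coeffDer_X {σ R : Type*} [CommRing R] [Algebra ℝ R] (d : Derivation ℝ R R) (v : σ) :
    coeffDer d (MvPolynomial.X v : MvPolynomial σ R) = 0 := by
  classical
  ext n
  rw [coeff_coeffDer, MvPolynomial.coeff_X, MvPolynomial.coeff_zero]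
  split_ifs <;> simp

/-- The operator `∂/∂w^{i,s}` on differential polynomials. -/
def jetPD (i : Fin r) : ℕ → Derivation ℝ (DP U) (DP U)
  | 0 => coeffDer (pd i)
  | s + 1 => (MvPolynomial.pderiv (i, s)).restrictScalars ℝ

/-- The total derivative `D = ∂_x = ∑_i ∑_{s ≥ 0} w^{i,s+1} ∂/∂w^{i,s}`. -/
def totD (U : Opens (Fin r → ℝ)) : Derivation ℝ (DP U) (DP U) :=
  (∑ i : Fin r, (MvPolynomial.X (i, 0) : DP U) • coeffDer (pd i)) +
    (MvPolynomial.mkDerivation (Sm U) fun v : Fin r × ℕ =>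
      (MvPolynomial.X (v.1, v.2 + 1) : DP U)).restrictScalars ℝ

lemma der_ext {S : Type*} [CommRing S] [Algebra ℝ S] {d₁ d₂ : DP U →ₗ[ℝ] S} (φ : DP U →ₐ[ℝ] S)
    (h₁ : ∀ f g, d₁ (f * g) = φ f * d₁ g + φ g * d₁ f)
    (h₂ : ∀ f g, d₂ (f * g) = φ f * d₂ g + φ g * d₂ f)
    (hC : ∀ c, d₁ (MvPolynomial.C c) = d₂ (MvPolynomial.C c))
    (hX : ∀ v, d₁ (MvPolynomial.X v) = d₂ (MvPolynomial.X v)) (f : DP U) : d₁ f = d₂ f := by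
  induction f using MvPolynomial.induction_on with
  | C c => exact hC c
  | add p q hp hq => rw [map_add, map_add, hp, hq]
  | mul_X p v hp => rw [h₁, h₂, hp, hX]

lemma derivation_sum_apply {ι R : Type*} [CommRing R] [Algebra ℝ R] (t : Finset ι)
    (d : ι → Derivation ℝ R R) (f : R) : (∑ i ∈ t, d i) f = ∑ i ∈ t, d i f := by
  classical
  induction t using Finset.induction_on with
  | empty => simp
  | insert a t h ih => rw [Finset.sum_insert h, Finset.sum_insert h, Derivation.add_apply, ih]

lemma totD_C (c : Sm U) :
    totD U (MvPolynomial.C c) = ∑ i : Fin r, MvPolynomial.X (i, 0) * MvPolynomial.C (pd i c) := by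
  simp [totD, Derivation.add_apply, derivation_sum_apply, coeffDer_C]

lemma totD_X (v : Fin r × ℕ) : totD U (MvPolynomial.X v) = MvPolynomial.X (v.1, v.2 + 1) := by
  simp [totD, Derivation.add_apply, derivation_sum_apply, coeffDer_X]

lemma jetPD_zero_C (i : Fin r) (c : Sm U) :
    jetPD i 0 (MvPolynomial.C c) = MvPolynomial.C (pd i c) := coeffDer_C _ _

lemma jetPD_zero_X (i : Fin r) (v : Fin r × ℕ) : jetPD i 0 (MvPolynomial.X v : DP U) = 0 :=
  coeffDer_X _ _

lemma jetPD_succ_C (i : Fin r) (s : ℕ) (c : Sm U) : jetPD i (s + 1) (MvPolynomial.C c) = 0 := by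
  simp [jetPD]

lemma jetPD_succ_X (i : Fin r) (s : ℕ) (v : Fin r × ℕ) :
    jetPD i (s + 1) (MvPolynomial.X v : DP U) = if v = (i, s) then 1 else 0 := by
  classical
  simp [jetPD, MvPolynomial.pderiv_X, Pi.single_apply]

lemma dp_derivation_ext {d₁ d₂ : Derivation ℝ (DP U) (DP U)}
    (hC : ∀ c, d₁ (MvPolynomial.C c) = d₂ (MvPolynomial.C c))
    (hX : ∀ v, d₁ (MvPolynomial.X v) = d₂ (MvPolynomial.X v)) : d₁ = d₂ :=
  Derivation.ext fun f => der_ext (d₁ := d₁.toLinearMap) (d₂ := d₂.toLinearMap) (AlgHom.id ℝ _)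
    (fun f g => d₁.leibniz f g) (fun f g => d₂.leibniz f g) hC hX f

/-- `[∂/∂w^{i,0}, D] = 0`. -/
lemma jetPD_zero_totD (i : Fin r) (f : DP U) : jetPD i 0 (totD U f) = totD U (jetPD i 0 f) := by
  have h : ⁅(jetPD i 0 : Derivation ℝ (DP U) (DP U)), totD U⁆ = 0 := by
    refine dp_derivation_ext (fun c => ?_) (fun v => ?_)
    · simp [Derivation.commutator_apply, totD_C, jetPD_zero_C, jetPD_zero_X, pd_comm i]
    · simp [Derivation.commutator_apply, totD_X, jetPD_zero_X]
  have := congrArg (fun d : Derivation ℝ (DP U) (DP U) => d f) h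
  rw [Derivation.commutator_apply] at this
  simpa [sub_eq_zero] using this

/-- `[∂/∂w^{i,s+1}, D] = ∂/∂w^{i,s}`. -/
lemma jetPD_succ_totD (i : Fin r) (s : ℕ) (f : DP U) :
    jetPD i (s + 1) (totD U f) = totD U (jetPD i (s + 1) f) + jetPD i s f := by
  have h : ⁅(jetPD i (s + 1) : Derivation ℝ (DP U) (DP U)), totD U⁆ = jetPD i s := by
    refine dp_derivation_ext (fun c => ?_) (fun v => ?_)
    · cases s with
      | zero =>
        simp [Derivation.commutator_apply, totD_C, jetPD_zero_C, jetPD_succ_C, jetPD_succ_X]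
      | succ s =>
        simp [Derivation.commutator_apply, totD_C, jetPD_succ_C, jetPD_succ_X]
    · obtain ⟨j, t⟩ := v
      have h0 : ∀ s, totD U (if (j, t) = (i, s) then 1 else 0) = 0 := by
        intro s; split_ifs <;> simp
      cases s with
      | zero =>
        rw [Derivation.commutator_apply, totD_X, jetPD_succ_X, jetPD_succ_X, h0, jetPD_zero_X]
        simp
      | succ s =>
        rw [Derivation.commutator_apply, totD_X, jetPD_succ_X, jetPD_succ_X, h0, jetPD_succ_X]
        simp
  have := congrArg (fun d : Derivation ℝ (DP U) (DP U) => d f) h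
  rw [Derivation.commutator_apply] at this
  rw [← this]; ring

/-! ### Homogeneity -/

lemma Hom.add {d : ℕ} {f g : DP U} (hf : Hom d f) (hg : Hom d g) : Hom d (f + g) :=
  MvPolynomial.IsWeightedHomogeneous.add hf hg

lemma hom_zero (d : ℕ) : Hom d (0 : DP U) := MvPolynomial.isWeightedHomogeneous_zero _ _ _

lemma hom_sum {ι : Type*} {d : ℕ} (t : Finset ι) (f : ι → DP U) (h : ∀ i ∈ t, Hom d (f i)) :
    Hom d (∑ i ∈ t, f i) :=
  (MvPolynomial.weightedHomogeneousSubmodule (Sm U) wt d).sum_mem h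

lemma hom_sub {d : ℕ} {f g : DP U} (hf : Hom d f) (hg : Hom d g) : Hom d (f - g) :=
  (MvPolynomial.weightedHomogeneousSubmodule (Sm U) wt d).sub_mem hf hg

lemma hom_neg {d : ℕ} {f : DP U} (hf : Hom d f) : Hom d (-f) :=
  (MvPolynomial.weightedHomogeneousSubmodule (Sm U) wt d).neg_mem hf

lemma hom_C (c : Sm U) : Hom 0 (MvPolynomial.C c : DP U) :=
  MvPolynomial.isWeightedHomogeneous_C _ _

lemma hom_smul {d : ℕ} (c : ℝ) {f : DP U} (hf : Hom d f) : Hom d (c • f) := by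
  have h := MvPolynomial.IsWeightedHomogeneous.mul (hom_C (U := U) (algebraMap ℝ (Sm U) c)) hf
  rw [zero_add] at h
  rwa [Algebra.smul_def, MvPolynomial.algebraMap_apply]

lemma hom_X (i : Fin r) (s : ℕ) : Hom (s + 1) (MvPolynomial.X (i, s) : DP U) :=
  MvPolynomial.isWeightedHomogeneous_X _ _ _

lemma hom_mul {d e : ℕ} {f g : DP U} (hf : Hom d f) (hg : Hom e g) : Hom (d + e) (f * g) :=
  MvPolynomial.IsWeightedHomogeneous.mul hf hg

lemma lt_of_mem_vars {d : ℕ} {f : DP U} (hf : Hom d f) {v : Fin r × ℕ} (hv : v ∈ f.vars) :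
    v.2 < d := by
  obtain ⟨m, hm, hmv⟩ := MvPolynomial.mem_vars_iff_mem_support v |>.1 hv
  have h1 := hf (MvPolynomial.mem_support_iff.1 hm)
  have h2 := Finsupp.le_weight_of_ne_zero' (wt : Fin r × ℕ → ℕ) (Finsupp.mem_support_iff.1 hmv)
  rw [h1] at h2
  exact h2

lemma hom_jetPD {d : ℕ} (i : Fin r) (s : ℕ) {f : DP U} (hf : Hom (d + s) f) :
    Hom d (jetPD i s f) := by
  cases s with
  | zero =>
    intro n hn
    refine hf (d := n) fun h0 => hn ?_
    exact (coeff_coeffDer (pd i) f n).trans (by rw [h0, map_zero])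
  | succ s => exact MvPolynomial.IsWeightedHomogeneous.pderiv hf rfl

lemma jetPD_eq_zero {d : ℕ} (i : Fin r) {s : ℕ} {f : DP U} (hf : Hom d f) (h : d < s) :
    jetPD i s f = 0 := by
  cases s with
  | zero => omega
  | succ s =>
    refine MvPolynomial.pderiv_eq_zero_of_notMem_vars fun hv => ?_
    have := lt_of_mem_vars hf hv
    simp only at this
    omega

lemma totD_eq_sum {d N : ℕ} {f : DP U} (hf : Hom d f) (h : d < N) :
    totD U f = ∑ i : Fin r, ∑ s ∈ Finset.range N, MvPolynomial.X (i, s) * jetPD i s f := by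
  classical
  obtain ⟨N, rfl⟩ : ∃ M, N = M + 1 := ⟨N - 1, by omega⟩
  have key : (MvPolynomial.mkDerivation (Sm U) fun v : Fin r × ℕ =>
      (MvPolynomial.X (v.1, v.2 + 1) : DP U)) f =
      (∑ v ∈ (Finset.univ : Finset (Fin r)) ×ˢ Finset.range N,
        (MvPolynomial.X (v.1, v.2 + 1) : DP U) • MvPolynomial.pderiv (R := Sm U) v) f := by
    refine MvPolynomial.derivation_eq_of_forall_mem_vars fun v hv => ?_
    have hlt := lt_of_mem_vars hf hv
    have hsum : ∀ (t : Finset (Fin r × ℕ)) (d : Fin r × ℕ → Derivation (Sm U) (DP U) (DP U))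
        (g : DP U), (∑ i ∈ t, d i) g = ∑ i ∈ t, d i g := by
      intro t d g
      induction t using Finset.induction_on with
      | empty => simp
      | insert a t h ih => rw [Finset.sum_insert h, Finset.sum_insert h, Derivation.add_apply, ih]
    rw [hsum, Finset.sum_eq_single v]
    · simp
    · intro b _ hb
      simp [MvPolynomial.pderiv_X_of_ne (Ne.symm hb)]
    · intro hn
      exact absurd (Finset.mem_product.2 ⟨Finset.mem_univ _, Finset.mem_range.2 (by omega)⟩) hn
  have hsum : ∀ (t : Finset (Fin r × ℕ)) (d : Fin r × ℕ → Derivation (Sm U) (DP U) (DP U))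
      (g : DP U), (∑ i ∈ t, d i) g = ∑ i ∈ t, d i g := by
    intro t d g
    induction t using Finset.induction_on with
    | empty => simp
    | insert a t h ih => rw [Finset.sum_insert h, Finset.sum_insert h, Derivation.add_apply, ih]
  rw [hsum, Finset.sum_product] at key
  simp only [Finset.sum_range_succ', Finset.sum_add_distrib]
  rw [totD, Derivation.add_apply, derivation_sum_apply, add_comm]
  exact congrArg₂ (· + ·) key rfl

lemma hom_totD {d : ℕ} {f : DP U} (hf : Hom d f) : Hom (d + 1) (totD U f) := by
  rw [totD_eq_sum hf (Nat.lt_succ_self d)]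
  refine hom_sum _ _ fun i _ => hom_sum _ _ fun s hs => ?_
  have hs' : s ≤ d := Nat.lt_succ_iff.1 (Finset.mem_range.1 hs)
  have h1 : Hom (d - s) (jetPD i s f) := hom_jetPD i s (by rwa [Nat.sub_add_cancel hs'])
  have := hom_mul (hom_X (U := U) i s) h1
  rwa [show s + 1 + (d - s) = d + 1 by omega] at this

/-! ### Higher Euler operators -/

/-- `∑_{0 ≤ b < N} (-∂_x)^b ∂f/∂w^{i,a+b}`. For `N` large and `a = 0` this is the variational
derivative of `f` with respect to `w^i`. -/
def eul (i : Fin r) (a N : ℕ) : DP U →ₗ[ℝ] DP U :=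
  ∑ b ∈ Finset.range N, ((-(totD U).toLinearMap) ^ b) ∘ₗ (jetPD i (a + b)).toLinearMap

lemma eul_apply (i : Fin r) (a N : ℕ) (f : DP U) :
    eul i a N f = ∑ b ∈ Finset.range N, ((-(totD U).toLinearMap) ^ b) (jetPD i (a + b) f) := by
  simp [eul, LinearMap.sum_apply]

lemma hom_negD_pow {d : ℕ} (b : ℕ) {f : DP U} (hf : Hom d f) :
    Hom (d + b) (((-(totD U).toLinearMap) ^ b) f) := by
  induction b with
  | zero => simpa using hf
  | succ b ih =>
    rw [pow_succ', Module.End.mul_apply]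
    exact hom_neg (hom_totD ih)

lemma hom_eul {d : ℕ} (i : Fin r) (a N : ℕ) {f : DP U} (hf : Hom (d + a) f) :
    Hom d (eul i a N f) := by
  rw [eul_apply]
  refine hom_sum _ _ fun b _ => ?_
  by_cases hb : b ≤ d
  · have h1 : Hom (d - b) (jetPD i (a + b) f) := hom_jetPD i _ (by
      rwa [show d - b + (a + b) = d + a by omega])
    have := hom_negD_pow b h1
    rwa [Nat.sub_add_cancel hb] at this
  · rw [jetPD_eq_zero i hf (by omega), map_zero]
    exact hom_zero _

lemma negD_pow_succ (b : ℕ) (f : DP U) :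
    ((-(totD U).toLinearMap) ^ (b + 1)) f = -((-(totD U).toLinearMap) ^ b) (totD U f) := by
  rw [pow_succ, Module.End.mul_apply, LinearMap.neg_apply, map_neg]; rfl

lemma eul_zero_totD (i : Fin r) (N : ℕ) (f : DP U) :
    eul i 0 (N + 1) (totD U f) = -((-(totD U).toLinearMap) ^ (N + 1)) (jetPD i N f) := by
  rw [eul_apply]
  induction N with
  | zero => simp [jetPD_zero_totD]
  | succ N ih =>
    rw [Finset.sum_range_succ, ih, zero_add, jetPD_succ_totD, map_add, negD_pow_succ (N + 1)]
    ring

lemma eul_succ_totD (i : Fin r) (a N : ℕ) (f : DP U) :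
    eul i (a + 1) N (totD U f) =
      jetPD i a f - ((-(totD U).toLinearMap) ^ N) (jetPD i (a + N) f) := by
  rw [eul_apply]
  induction N with
  | zero => simp
  | succ N ih =>
    rw [Finset.sum_range_succ, ih, show a + 1 + N = a + N + 1 by ring, jetPD_succ_totD, map_add,
      negD_pow_succ N, show a + (N + 1) = a + N + 1 by ring]
    ring

lemma totD_eul_succ (i : Fin r) (a N : ℕ) (f : DP U) :
    totD U (eul i (a + 1) N f) = jetPD i a f - eul i a (N + 1) f := by
  rw [eul_apply, eul_apply, Finset.sum_range_succ', map_sum]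
  simp only [pow_zero, Module.End.one_apply, add_zero]
  rw [sub_add_eq_sub_sub_swap, sub_self, zero_sub, ← Finset.sum_neg_distrib]
  refine Finset.sum_congr rfl fun b _ => ?_
  rw [pow_succ', Module.End.mul_apply, LinearMap.neg_apply, neg_neg,
    show a + 1 + b = a + (b + 1) by ring]
  rfl

/-! ### The completed ring `𝒜` -/

/-- Formal series `∑_d f_d` of differential polynomials, `f_d` homogeneous of degree `d`. -/
def gradedSeries (U : Opens (Fin r → ℝ)) : Subalgebra ℝ (PowerSeries (DP U)) where
  carrier := {F | ∀ d, Hom d (PowerSeries.coeff d F)}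
  mul_mem' {F G} hF hG d := by
    rw [PowerSeries.coeff_mul]
    refine hom_sum _ _ fun x hx => ?_
    have := hom_mul (hF x.1) (hG x.2)
    rwa [Finset.HasAntidiagonal.mem_antidiagonal.1 hx] at this
  add_mem' {F G} hF hG d := by
    rw [map_add]
    exact (hF d).add (hG d)
  algebraMap_mem' c d := by
    rw [PowerSeries.algebraMap_apply, PowerSeries.coeff_C]
    split_ifs with h
    · subst h
      exact hom_C _
    · exact hom_zero _

/-- The ring `𝒜` over `U`: the completion of the ring of differential polynomials with respect to
the degree `deg w^{i,s} = s`. (The power series variable is the bookkeeping symbol that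
accompanies each `x`-derivative.) -/
def DA (U : Opens (Fin r → ℝ)) : Type := gradedSeries U

instance : CommRing (DA U) := inferInstanceAs (CommRing (gradedSeries U))

instance : Algebra ℝ (DA U) := inferInstanceAs (Algebra ℝ (gradedSeries U))

/-- The component of degree `d` of an element of `𝒜`. -/
def comp (d : ℕ) : DA U →ₗ[ℝ] DP U where
  toFun F := PowerSeries.coeff d (Subtype.val (show gradedSeries U from F))
  map_add' _ _ := rfl
  map_smul' _ _ := rfl

lemma hom_comp (d : ℕ) (F : DA U) : Hom d (comp d F) := (show gradedSeries U from F).2 d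

lemma DA.ext {F G : DA U} (h : ∀ d, comp d F = comp d G) : F = G :=
  Subtype.ext (PowerSeries.ext h)

lemma comp_mul (d : ℕ) (F G : DA U) :
    comp d (F * G) = ∑ x ∈ Finset.HasAntidiagonal.antidiagonal d, comp x.1 F * comp x.2 G :=
  PowerSeries.coeff_mul _ _ _

/-- The element of `𝒜` with given homogeneous components. -/
def DA.mk (g : ℕ → DP U) (hg : ∀ d, Hom d (g d)) : DA U :=
  (⟨PowerSeries.mk g, fun d => by rw [PowerSeries.coeff_mk]; exact hg d⟩ : gradedSeries U)

@[simp] lemma comp_mk (g : ℕ → DP U) (hg : ∀ d, Hom d (g d)) (d : ℕ) :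
    comp d (DA.mk g hg) = g d := PowerSeries.coeff_mk _ _

/-- The components of `∂_x F`. -/
def dxComp (F : DA U) : ℕ → DP U
  | 0 => 0
  | d + 1 => totD U (comp d F)

lemma hom_dxComp (F : DA U) (d : ℕ) : Hom d (dxComp F d) := by
  cases d with
  | zero => exact hom_zero _
  | succ d => exact hom_totD (hom_comp d F)

/-- `∂_x` as a linear map on `𝒜`. -/
def dxLin (U : Opens (Fin r → ℝ)) : DA U →ₗ[ℝ] DA U where
  toFun F := DA.mk (dxComp F) (hom_dxComp F)
  map_add' F G := DA.ext fun d => by cases d <;> simp [dxComp]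
  map_smul' c F := DA.ext fun d => by cases d <;> simp [dxComp]

lemma comp_zero_dxLin (F : DA U) : comp 0 (dxLin U F) = 0 := comp_mk _ (hom_dxComp F) 0

lemma comp_succ_dxLin (d : ℕ) (F : DA U) : comp (d + 1) (dxLin U F) = totD U (comp d F) :=
  comp_mk _ (hom_dxComp F) (d + 1)

lemma dxLin_leibniz (F G : DA U) : dxLin U (F * G) = F • dxLin U G + G • dxLin U F :=
  DA.ext fun d => by
    rw [smul_eq_mul, smul_eq_mul, map_add, comp_mul d F, comp_mul d G]
    cases d with
    | zero => simp [comp_zero_dxLin]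
    | succ d =>
      rw [comp_succ_dxLin, comp_mul, map_sum, Finset.Nat.sum_antidiagonal_succ',
        Finset.Nat.sum_antidiagonal_succ', comp_zero_dxLin, comp_zero_dxLin, mul_zero, mul_zero,
        zero_add, zero_add]
      simp only [comp_succ_dxLin, Derivation.leibniz, smul_eq_mul, Finset.sum_add_distrib]
      congr 1
      exact Finset.Nat.sum_antidiagonal_swap
        (f := fun p => comp p.1 G * totD U (comp p.2 F))

/-- The derivation `∂_x` of `𝒜`; it has degree `1`. -/
def dx (U : Opens (Fin r → ℝ)) : Derivation ℝ (DA U) (DA U) :=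
  Derivation.mk' (dxLin U) dxLin_leibniz

@[simp] lemma comp_zero_dx (F : DA U) : comp 0 (dx U F) = 0 :=
  comp_mk _ (hom_dxComp F) 0

@[simp] lemma comp_succ_dx (d : ℕ) (F : DA U) : comp (d + 1) (dx U F) = totD U (comp d F) :=
  comp_mk _ (hom_dxComp F) (d + 1)

/-- `C^∞(U) ⊆ 𝒜`. -/
def cst : Sm U →+* DA U where
  toFun c := DA.mk (fun d => if d = 0 then MvPolynomial.C c else 0) fun d => by
    split_ifs with h
    · subst h
      exact hom_C c
    · exact hom_zero _
  map_one' := DA.ext fun d => by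
    rw [comp_mk, map_one]
    exact (PowerSeries.coeff_one (R := DP U) d).symm
  map_zero' := DA.ext fun d => by simp
  map_add' a b := DA.ext fun d => by
    simp only [comp_mk, map_add]
    split_ifs <;> simp
  map_mul' a b := DA.ext fun d => by
    rw [comp_mul]
    simp only [comp_mk, map_mul]
    cases d with
    | zero => simp
    | succ d =>
      rw [if_neg (Nat.succ_ne_zero d), Finset.Nat.sum_antidiagonal_succ]
      simp

/-- A family of linear maps preserving homogeneous components of each degree acts on `𝒜`. -/
def gradedMap (L : ℕ → DP U →ₗ[ℝ] DP V) (hL : ∀ d f, Hom d f → Hom d (L d f)) :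
    DA U →ₗ[ℝ] DA V where
  toFun F := DA.mk (fun d => L d (comp d F)) fun d => hL d _ (hom_comp d F)
  map_add' F G := DA.ext fun d => by simp
  map_smul' c F := DA.ext fun d => by simp

@[simp] lemma comp_gradedMap (L : ℕ → DP U →ₗ[ℝ] DP V) (hL : ∀ d f, Hom d f → Hom d (L d f))
    (d : ℕ) (F : DA U) : comp d (gradedMap L hL F) = L d (comp d F) :=
  comp_mk _ (fun d => hL d _ (hom_comp d F)) d

/-! ### Variational derivatives and the operator `W` -/

/-- The variational derivative `δF/δw^i = ∑_s (-∂_x)^s ∂f/∂w^{i,s}` of `F = ∫ f dx`, as an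
operator on densities. (A density of degree `d` does not involve `w^{i,s}` for `s > d`.) -/
def varA (i : Fin r) : DA U →ₗ[ℝ] DA U :=
  gradedMap (fun d => eul i 0 (d + 1)) fun _ _ hf => hom_eul i 0 _ hf

/-- The degree `d` part of the operator `W`. -/
def WComp (d : ℕ) : DP U →ₗ[ℝ] DP U :=
  LinearMap.id - ∑ i : Fin r, ∑ a ∈ Finset.range d,
    LinearMap.mulLeft ℝ (MvPolynomial.X (i, a) : DP U) ∘ₗ eul i (a + 1) (d + 1)

lemma WComp_apply (d : ℕ) (f : DP U) : WComp d f = f - ∑ i : Fin r, ∑ a ∈ Finset.range d,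
    MvPolynomial.X (i, a) * eul i (a + 1) (d + 1) f := by
  simp [WComp, LinearMap.sum_apply]

/-- `W(F) = f - ∑_i ∑_{a, b ≥ 0} w^{i,a+1} (-∂_x)^b ∂f/∂w^{i,a+b+1}` for `F = ∫ f dx`. This is
`∂_x⁻¹(∑_i w^i_x δF/δw^i)` (see `dx_WA`), normalised so that its component of degree `0` is that
of `f`. -/
def WA : DA U →ₗ[ℝ] DA U := gradedMap WComp fun d f hf => by
  rw [WComp_apply]
  refine hom_sub hf (hom_sum _ _ fun i _ => hom_sum _ _ fun a ha => ?_)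
  have ha' := Finset.mem_range.1 ha
  have h1 : Hom (d - (a + 1)) (eul i (a + 1) (d + 1) f) :=
    hom_eul i (a + 1) _ (by rwa [Nat.sub_add_cancel ha'])
  have := hom_mul (hom_X (U := U) i a) h1
  rwa [show a + 1 + (d - (a + 1)) = d by omega] at this

/-- Variational derivatives of total derivatives vanish. -/
lemma varA_dx (i : Fin r) (F : DA U) : varA i (dx U F) = 0 := DA.ext fun d => by
  rw [varA, comp_gradedMap, map_zero]
  cases d with
  | zero => simp
  | succ d =>
    rw [comp_succ_dx, eul_zero_totD, jetPD_eq_zero i (hom_comp d F) (Nat.lt_succ_self d), map_zero,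
      neg_zero]

lemma WA_dx (F : DA U) : WA (dx U F) = 0 := DA.ext fun d => by
  rw [WA, comp_gradedMap, map_zero, WComp_apply]
  cases d with
  | zero => simp
  | succ d =>
    rw [comp_succ_dx, totD_eq_sum (hom_comp d F) (Nat.lt_succ_self d), ← totD_eq_sum (hom_comp d F)
      (Nat.lt_succ_self d), sub_eq_zero]
    rw [totD_eq_sum (hom_comp d F) (Nat.lt_succ_self d)]
    refine Finset.sum_congr rfl fun i _ => Finset.sum_congr rfl fun a _ => ?_
    rw [← totD_eq_sum (hom_comp d F) (Nat.lt_succ_self d), eul_succ_totD,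
      jetPD_eq_zero i (hom_comp d F) (show d < a + (d + 1 + 1) by omega), map_zero, sub_zero]

lemma eul_stable {d : ℕ} (i : Fin r) (a : ℕ) {f : DP U} (hf : Hom d f) {N M : ℕ} (hN : d < a + N)
    (hNM : N ≤ M) : eul i a M f = eul i a N f := by
  obtain ⟨k, rfl⟩ := Nat.exists_eq_add_of_le hNM
  induction k with
  | zero => rfl
  | succ k ih =>
    rw [← add_assoc, eul_apply, Finset.sum_range_succ, ← eul_apply, ih (by omega),
      jetPD_eq_zero i hf (by omega), map_zero, add_zero]

lemma totD_WComp {d : ℕ} {f : DP U} (hf : Hom d f) :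
    totD U (WComp d f) = ∑ i : Fin r, MvPolynomial.X (i, 0) * eul i 0 (d + 1) f := by
  rw [WComp_apply, map_sub, totD_eq_sum hf (Nat.lt_succ_self d), map_sum, ← Finset.sum_sub_distrib]
  refine Finset.sum_congr rfl fun i _ => ?_
  rw [map_sum]
  simp only [Derivation.leibniz, smul_eq_mul, totD_X, totD_eul_succ, mul_sub,
    Finset.sum_add_distrib, Finset.sum_sub_distrib]
  have h1 : ∀ a, eul i a (d + 1 + 1) f = eul i a (d + 1) f := fun a =>
    eul_stable i a hf (by omega) (by omega)
  simp only [h1]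
  have h2 : eul i (d + 1) (d + 1) f = 0 := by
    rw [eul_apply]
    refine Finset.sum_eq_zero fun b _ => ?_
    rw [jetPD_eq_zero i hf (by omega), map_zero]
  have h3 := Finset.sum_range_succ' (fun a => MvPolynomial.X (i, a) * eul i a (d + 1) f) d
  have h4 : (∑ a ∈ Finset.range d, MvPolynomial.X (i, a) * jetPD i a f) +
      MvPolynomial.X (i, d) * jetPD i d f = ∑ a ∈ Finset.range (d + 1),
        MvPolynomial.X (i, a) * jetPD i a f := (Finset.sum_range_succ _ _).symm
  have h5 := Finset.sum_range_succ (fun a => MvPolynomial.X (i, a) * eul i a (d + 1) f) d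
  have h6 : eul i d (d + 1) f = jetPD i d f := by
    have := totD_eul_succ i d (d + 1) f
    rw [h2, map_zero, h1] at this
    exact (sub_eq_zero.1 this.symm).symm
  simp only [h6] at h5
  have h7 : ∀ a, eul i (a + 1) (d + 1) f * MvPolynomial.X (i, a + 1) =
    MvPolynomial.X (i, a + 1) * eul i (a + 1) (d + 1) f := fun a => mul_comm _ _
  simp only [h7]
  linear_combination -h4 + h3 - h5

/-- `w^k ∈ 𝒜`, for `k ∈ ℤ`. -/
def w (U : Opens (Fin r → ℝ)) (k : ℤ) : DA U := cst (wSm U k)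

lemma coord_fin (p : Fin r → ℝ) (i : Fin r) : coord p (i : ℤ) = p i := by
  have h : 0 ≤ (i : ℤ) ∧ (i : ℤ) < r := ⟨by positivity, by exact_mod_cast i.2⟩
  rw [coord, dif_pos h]
  congr 1

lemma pd_wSm (k i : Fin r) : pd k (wSm U (i : ℤ)) = if k = i then 1 else 0 := by
  refine Sm.ext fun p => ?_
  have h1 : zeroExt (wSm U (i : ℤ)).val =ᶠ[nhds (p : Fin r → ℝ)] fun q => q i :=
    (zeroExt_ofFun_eventuallyEq _ _ p).trans (Filter.Eventually.of_forall fun q => coord_fin q i)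
  rw [pd_apply, h1.fderiv_eq]
  have h2 : HasFDerivAt (fun q : Fin r → ℝ => q i) (ContinuousLinearMap.proj i) (p : Fin r → ℝ) :=
    (ContinuousLinearMap.proj (R := ℝ) (φ := fun _ : Fin r => ℝ) i).hasFDerivAt
  rw [h2.fderiv]
  simp only [ContinuousLinearMap.proj_apply, Pi.single_apply]
  by_cases h : k = i
  · subst h; simp [Sm.val_one]
  · rw [if_neg h, if_neg (Ne.symm h)]; rfl

lemma comp_dx_w (i : Fin r) (d : ℕ) :
    comp d (dx U (w U (i : ℤ))) = if d = 1 then MvPolynomial.X (i, 0) else 0 := by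
  cases d with
  | zero => simp
  | succ d =>
    rw [comp_succ_dx, w, cst]
    cases d with
    | zero =>
      simp only [RingHom.coe_mk, MonoidHom.coe_mk, OneHom.coe_mk, comp_mk]
      simp [totD_C, pd_wSm, apply_ite (MvPolynomial.C (σ := Fin r × ℕ) (R := Sm U))]
    | succ d => simp

lemma comp_dx_w_mul (i : Fin r) (d : ℕ) (G : DA U) :
    comp (d + 1) (dx U (w U (i : ℤ)) * G) = MvPolynomial.X (i, 0) * comp d G := by
  rw [comp_mul, Finset.sum_eq_single (1, d)]
  · rw [comp_dx_w]; simp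
  · rintro ⟨x, y⟩ hxy hne
    rw [comp_dx_w, if_neg, zero_mul]
    rintro h
    have := (Finset.HasAntidiagonal.mem_antidiagonal.1 hxy)
    simp only at this h
    exact hne (Prod.ext h (by simp only; omega))
  · intro hn
    exact absurd (Finset.HasAntidiagonal.mem_antidiagonal.2 (by simp only; omega)) hn

/-- `∂_x W(F) = ∑_i w^i_x δF/δw^i`. -/
lemma dx_WA (F : DA U) : dx U (WA F) = ∑ i : Fin r, dx U (w U (i : ℤ)) * varA i F :=
  DA.ext fun d => by
    cases d with
    | zero =>
      rw [comp_zero_dx, map_sum]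
      refine (Finset.sum_eq_zero fun i _ => ?_).symm
      rw [comp_mul]
      simp
    | succ d =>
      rw [comp_succ_dx, WA, comp_gradedMap, totD_WComp (hom_comp d F), map_sum]
      refine Finset.sum_congr rfl fun i _ => ?_
      rw [comp_dx_w_mul, varA, comp_gradedMap]

/-! ### The operators `𝒟_k` and the antiderivative occurring in the nonlocal structures -/

/-- `a_k` for `k ∈ ℤ`, with `a_k = 0` for `k < 0` or `k > r`. -/
def par (a : Fin (r + 1) → ℝ) (k : ℤ) : ℝ :=
  if h : 0 ≤ k ∧ k ≤ r then a ⟨k.toNat, by omega⟩ else 0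

/-- `𝒟_k = 2 w^k ∂_x + w^k_x - (ε²/2) a_k ∂_x³`. -/
def Dop (U : Opens (Fin r → ℝ)) (ε : ℝ) (a : Fin (r + 1) → ℝ) (k : ℤ) : DA U →ₗ[ℝ] DA U :=
  (2 : ℝ) • LinearMap.mulLeft ℝ (w U k) ∘ₗ (dx U).toLinearMap +
    LinearMap.mulLeft ℝ (dx U (w U k)) - (ε ^ 2 / 2 * par a k) • (dx U).toLinearMap ^ 3

lemma Dop_apply (ε : ℝ) (a : Fin (r + 1) → ℝ) (k : ℤ) (F : DA U) :
    Dop U ε a k F = (2 : ℝ) • (w U k * dx U F) + dx U (w U k) * F -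
      (ε ^ 2 / 2 * par a k) • dx U (dx U (dx U F)) := by
  simp [Dop, pow_succ, Module.End.mul_apply]

lemma comp_dx_pow_eq_zero {d n : ℕ} (h : d < n) (F : DA U) :
    comp d (((dx U).toLinearMap ^ n) F) = 0 := by
  induction n generalizing d with
  | zero => omega
  | succ n ih =>
    rw [pow_succ', Module.End.mul_apply]
    cases d with
    | zero => exact comp_zero_dx _
    | succ d =>
      refine (comp_succ_dx d _).trans ?_
      rw [ih (by omega), map_zero]

/-- `(1 - c ∂_x²)⁻¹ = ∑_k c^k ∂_x^{2k}` on `𝒜`; see `geom_spec`. (The component of degree `d` of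
`∂_x^{2k} F` vanishes for `2k > d`.) -/
def geom (U : Opens (Fin r → ℝ)) (c : ℝ) : DA U →ₗ[ℝ] DA U where
  toFun F := DA.mk
    (fun d => ∑ k ∈ Finset.range (d + 1), c ^ k • comp d (((dx U).toLinearMap ^ (2 * k)) F))
    fun d => hom_sum _ _ fun _ _ => hom_smul _ (hom_comp d _)
  map_add' F G := DA.ext fun d => by simp [Finset.sum_add_distrib]
  map_smul' b F := DA.ext fun d => by
    simp only [comp_mk, map_smul, RingHom.id_apply, Finset.smul_sum]
    exact Finset.sum_congr rfl fun k _ => smul_comm _ _ _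

lemma comp_geom (c : ℝ) (F : DA U) (d : ℕ) : comp d (geom U c F) =
    ∑ k ∈ Finset.range (d + 1), c ^ k • comp d (((dx U).toLinearMap ^ (2 * k)) F) :=
  comp_mk _ (fun d => hom_sum _ _ fun _ _ => hom_smul _ (hom_comp d _)) d

lemma comp_geom_eq (c : ℝ) (F : DA U) {d N : ℕ} (h : d < N) : comp d (geom U c F) =
    comp d (∑ k ∈ Finset.range N, c ^ k • ((dx U).toLinearMap ^ (2 * k)) F) := by
  rw [comp_geom, map_sum]
  simp only [map_smul]
  refine Finset.sum_subset (Finset.range_mono h) fun k _ hk => ?_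
  rw [comp_dx_pow_eq_zero, smul_zero]
  have : ¬ k < d + 1 := fun h => hk (Finset.mem_range.2 h)
  omega

lemma geom_spec (c : ℝ) (F : DA U) :
    geom U c F - c • dx U (dx U (geom U c F)) = F := DA.ext fun d => by
  set G := ∑ k ∈ Finset.range (d + 1), c ^ k • ((dx U).toLinearMap ^ (2 * k)) F with hG
  have h1 : comp d (dx U (dx U (geom U c F))) = comp d (dx U (dx U G)) := by
    rcases d with _ | _ | d
    · simp
    · simp only [zero_add, comp_succ_dx, comp_zero_dx]
    · rw [comp_succ_dx, comp_succ_dx, comp_succ_dx, comp_succ_dx, 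
        comp_geom_eq c F (N := d + 1 + 1 + 1) (by omega)]
  have h2 : ∀ N : ℕ, (∑ k ∈ Finset.range N, c ^ k • ((dx U).toLinearMap ^ (2 * k)) F) -
      c • dx U (dx U (∑ k ∈ Finset.range N, c ^ k • ((dx U).toLinearMap ^ (2 * k)) F)) =
      F - c ^ N • ((dx U).toLinearMap ^ (2 * N)) F := by
    intro N
    induction N with
    | zero => simp
    | succ N ih =>
      have h3 : ((dx U).toLinearMap ^ (2 * (N + 1))) F =
          dx U (dx U (((dx U).toLinearMap ^ (2 * N)) F)) := by
        rw [show 2 * (N + 1) = 2 * N + 1 + 1 by ring, pow_succ', pow_succ']; rfl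
      rw [Finset.sum_range_succ, map_add, map_add, smul_add, add_sub_add_comm, ih, h3]
      simp only [Derivation.map_smul, smul_smul, ← pow_succ']
      abel
  rw [map_sub, map_smul, h1, comp_geom_eq c F (Nat.lt_succ_self d), ← hG, ← map_smul, ← map_sub,
    h2, map_sub, map_smul, comp_dx_pow_eq_zero (by omega), smul_zero, sub_zero]

/-- `S(F) = 𝒟_r⁻¹(∑_j 𝒟_j(δF/δw^j))`, as an operator on densities; see `Dop_SA`. Explicitly,
`𝒟_r⁻¹ = ½ (1 - (ε²/4) a_r ∂_x²)⁻¹ ∂_x⁻¹` and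
`∂_x⁻¹(∑_j 𝒟_j(δF/δw^j)) = ∑_j (2 w^j δF/δw^j - (ε²/2) a_j ∂_x² δF/δw^j) - W(F)`. -/
def SA (ε : ℝ) (a : Fin (r + 1) → ℝ) : DA U →ₗ[ℝ] DA U :=
  (1 / 2 : ℝ) • geom U (ε ^ 2 / 4 * par a r) ∘ₗ
    ((∑ j : Fin r, ((2 : ℝ) • LinearMap.mulLeft ℝ (w U (j : ℤ)) -
      (ε ^ 2 / 2 * par a (j : ℤ)) • (dx U).toLinearMap ^ 2) ∘ₗ varA j) - WA)

lemma SA_apply (ε : ℝ) (a : Fin (r + 1) → ℝ) (F : DA U) :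
    SA ε a F = (1 / 2 : ℝ) • geom U (ε ^ 2 / 4 * par a r)
      ((∑ j : Fin r, ((2 : ℝ) • (w U (j : ℤ) * varA j F) -
        (ε ^ 2 / 2 * par a (j : ℤ)) • dx U (dx U (varA j F)))) - WA F) := by
  simp [SA, LinearMap.sum_apply, pow_succ, Module.End.mul_apply]

lemma w_top : w U (r : ℤ) = 1 := by
  have : wSm U (r : ℤ) = 1 := Sm.ext fun p => by
    rw [wSm, Sm.val_ofFun, coord, dif_neg (by omega), if_pos rfl]; rfl
  rw [w, this, map_one]

lemma Dop_SA (ε : ℝ) (a : Fin (r + 1) → ℝ) (F : DA U) :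
    Dop U ε a r (SA ε a F) = ∑ j : Fin r, Dop U ε a (j : ℤ) (varA j F) := by
  set H : DA U := (∑ j : Fin r, ((2 : ℝ) • (w U (j : ℤ) * varA j F) -
        (ε ^ 2 / 2 * par a (j : ℤ)) • dx U (dx U (varA j F)))) - WA F with hH
  have h1 : SA ε a F = (1 / 2 : ℝ) • geom U (ε ^ 2 / 4 * par a r) H := SA_apply ε a F
  have h2 := congrArg (dx U) (geom_spec (ε ^ 2 / 4 * par a r) H)
  have h3 : dx U H = ∑ j : Fin r, Dop U ε a (j : ℤ) (varA j F) := by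
    rw [hH, map_sub, dx_WA, map_sum, ← Finset.sum_sub_distrib]
    refine Finset.sum_congr rfl fun j _ => ?_
    rw [Dop_apply, map_sub, Derivation.map_smul, Derivation.map_smul, Derivation.leibniz]
    simp only [smul_eq_mul, two_smul]
    ring
  rw [← h3, ← h2, h1, Dop_apply, w_top]
  simp only [map_sub, Derivation.map_smul, Derivation.map_one_eq_zero, one_mul, zero_mul, add_zero,
    smul_smul]
  congr 1
  · norm_num
  · congr 1; ring

lemma SA_dx (ε : ℝ) (a : Fin (r + 1) → ℝ) (F : DA U) : SA ε a (dx U F) = 0 := by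
  simp [SA, LinearMap.sum_apply, varA_dx, WA_dx]

/-- `𝒟_k` is skew-adjoint. -/
lemma Dop_skew (ε : ℝ) (a : Fin (r + 1) → ℝ) (k : ℤ) (F G : DA U) :
    F * Dop U ε a k G + G * Dop U ε a k F =
      dx U ((2 : ℝ) • (w U k * F * G) - (ε ^ 2 / 2 * par a k) •
        (F * dx U (dx U G) - dx U F * dx U G + G * dx U (dx U F))) := by
  rw [Dop_apply, Dop_apply]
  simp only [map_sub, map_add, Derivation.map_smul, Derivation.leibniz, smul_eq_mul]
  simp only [Algebra.smul_def, map_ofNat]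
  ring

/-! ### Local functionals and generalised multivectors -/

/-- `𝒜 / δ𝒜` for a linear operator `δ` on `𝒜`. -/
abbrev LamOf (δ : DA U →ₗ[ℝ] DA U) := DA U ⧸ LinearMap.range δ

/-- Local functionals `Λ = Λ_x = 𝒜 / ∂_x 𝒜`. -/
abbrev Lam (U : Opens (Fin r → ℝ)) := LamOf (dx U).toLinearMap

/-- `f ↦ ∫ f dx`. -/
def int (U : Opens (Fin r → ℝ)) : DA U →ₗ[ℝ] Lam U := Submodule.mkQ _

lemma int_dx (F : DA U) : int U (dx U F) = 0 :=
  (Submodule.Quotient.mk_eq_zero _).2 ⟨F, rfl⟩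

/-- `F ↦ δF/δw^i` on local functionals. -/
def var (i : Fin r) : Lam U →ₗ[ℝ] DA U :=
  Submodule.liftQ _ (varA i) (by rintro _ ⟨F, rfl⟩; exact varA_dx i F)

/-- `S(F) = 𝒟_r⁻¹(∑_j 𝒟_j(δF/δw^j))` on local functionals. -/
def nlS (ε : ℝ) (a : Fin (r + 1) → ℝ) : Lam U →ₗ[ℝ] DA U :=
  Submodule.liftQ _ (SA ε a) (by rintro _ ⟨F, rfl⟩; exact SA_dx ε a F)

lemma Dop_nlS (ε : ℝ) (a : Fin (r + 1) → ℝ) (F : Lam U) :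
    Dop U ε a r (nlS ε a F) = ∑ j : Fin r, Dop U ε a (j : ℤ) (var j F) := by
  obtain ⟨f, rfl⟩ := Submodule.Quotient.mk_surjective _ F
  exact Dop_SA ε a f

/-- The bilinear map `(F, G) ↦ ∫ u(F) 𝒟_k(v(G)) dx`. -/
def bra (ε : ℝ) (a : Fin (r + 1) → ℝ) (k : ℤ) (u v : Lam U →ₗ[ℝ] DA U) :
    Lam U →ₗ[ℝ] Lam U →ₗ[ℝ] Lam U :=
  LinearMap.mk₂ ℝ (fun F G => int U (u F * Dop U ε a k (v G)))
    (fun _ _ _ => by simp [add_mul]) (fun _ _ _ => by simp)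
    (fun _ _ _ => by simp [mul_add]) (fun _ _ _ => by simp)

lemma bra_apply (ε : ℝ) (a : Fin (r + 1) → ℝ) (k : ℤ) (u v : Lam U →ₗ[ℝ] DA U) (F G : Lam U) :
    bra ε a k u v F G = int U (u F * Dop U ε a k (v G)) := rfl

lemma bra_swap (ε : ℝ) (a : Fin (r + 1) → ℝ) (k : ℤ) (u v : Lam U →ₗ[ℝ] DA U) (F : Lam U) :
    bra ε a k u v F F = -bra ε a k v u F F := by
  rw [eq_neg_iff_add_eq_zero, bra_apply, bra_apply, ← map_add, Dop_skew, int_dx]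

lemma bra_self (ε : ℝ) (a : Fin (r + 1) → ℝ) (k : ℤ) (u : Lam U →ₗ[ℝ] DA U) (F : Lam U) :
    bra ε a k u u F F = 0 := by
  have h := bra_swap ε a k u u F
  rw [eq_neg_iff_add_eq_zero, ← two_smul ℝ] at h
  exact (smul_eq_zero.1 h).resolve_left two_ne_zero

/-- The constants `f_m^{ij}`: `1` for `i, j < m`, `-1` for `i, j ≥ m`, and `0` otherwise. -/
def fsgn (m : ℕ) (i j : Fin r) : ℝ :=
  if (i : ℕ) < m ∧ (j : ℕ) < m then 1 else if m ≤ (i : ℕ) ∧ m ≤ (j : ℕ) then -1 else 0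

lemma fsgn_comm (m : ℕ) (i j : Fin r) : fsgn m i j = fsgn m j i := by
  simp only [fsgn, and_comm]

/-- `(F, G) ↦ P_m(F, G) = ∫ ∑_{ij} δF/δw^i P_m^{ij}(δG/δw^j) dx`, where
`P_m^{ij} = f_m^{ij} 𝒟_{i+j+1-m}` for `m ≤ r`,
`P_{r+1}^{ij} = 𝒟_{i+j-r} - 𝒟_i 𝒟_r⁻¹ 𝒟_j` and
`P_{r+2}^{ij} = 𝒟_{i+j-r-1} - 𝒟_{i-1} 𝒟_r⁻¹ 𝒟_j - 𝒟_i 𝒟_r⁻¹ 𝒟_{j-1}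
+ 𝒟_i 𝒟_r⁻¹ 𝒟_{r-1} 𝒟_r⁻¹ 𝒟_j`.
Here `𝒟_r⁻¹ 𝒟_j(δG/δw^j)`, summed over `j`, is `S(G)`; and since all `𝒟_k` are skew-adjoint,
`∫ ∑_i δF/δw^i 𝒟_i 𝒟_r⁻¹(Y) dx` is `∫ S(F) Y dx`. -/
def Pform (ε : ℝ) (a : Fin (r + 1) → ℝ) (m : ℕ) : Lam U →ₗ[ℝ] Lam U →ₗ[ℝ] Lam U :=
  if m ≤ r then
    ∑ i : Fin r, ∑ j : Fin r, fsgn m i j • bra ε a ((i : ℤ) + j + 1 - m) (var i) (var j)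
  else if m = r + 1 then
    (∑ i : Fin r, ∑ j : Fin r, bra ε a ((i : ℤ) + j - r) (var i) (var j)) -
      ∑ i : Fin r, bra ε a (i : ℤ) (var i) (nlS ε a)
  else if m = r + 2 then
    (∑ i : Fin r, ∑ j : Fin r, bra ε a ((i : ℤ) + j - r - 1) (var i) (var j)) -
      (∑ i : Fin r, bra ε a ((i : ℤ) - 1) (var i) (nlS ε a)) -
      (∑ j : Fin r, bra ε a ((j : ℤ) - 1) (nlS ε a) (var j)) +
      bra ε a ((r : ℤ) - 1) (nlS ε a) (nlS ε a)
  else 0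

lemma sum_bra_eq_zero (ε : ℝ) (a : Fin (r + 1) → ℝ) (c : Fin r → Fin r → ℝ)
    (hc : ∀ i j, c i j = c j i) (k : Fin r → Fin r → ℤ) (hk : ∀ i j, k i j = k j i) (F : Lam U) :
    ∑ i : Fin r, ∑ j : Fin r, c i j • bra ε a (k i j) (var i) (var j) F F = 0 := by
  set s := ∑ i : Fin r, ∑ j : Fin r, c i j • bra ε a (k i j) (var i) (var j) F F with hs
  have h : s = -s := by
    conv_lhs => rw [hs, Finset.sum_comm]
    rw [hs, ← Finset.sum_neg_distrib]
    refine Finset.sum_congr rfl fun i _ => ?_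
    rw [← Finset.sum_neg_distrib]
    refine Finset.sum_congr rfl fun j _ => ?_
    rw [bra_swap, hc j i, hk j i, smul_neg]
  rw [eq_neg_iff_add_eq_zero, ← two_smul ℝ] at h
  exact (smul_eq_zero.1 h).resolve_left two_ne_zero

lemma Pform_self (ε : ℝ) (a : Fin (r + 1) → ℝ) (m : ℕ) (F : Lam U) : Pform ε a m F F = 0 := by
  unfold Pform
  split_ifs with h1 h2 h3
  · simp only [LinearMap.sum_apply, LinearMap.smul_apply]
    exact sum_bra_eq_zero ε a _ (fsgn_comm m) (fun i j => (i : ℤ) + j + 1 - m)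
      (fun i j => by ring) F
  · have h := sum_bra_eq_zero ε a (fun _ _ => 1) (fun _ _ => rfl) (fun i j => (i : ℤ) + j - r)
      (fun i j => by ring) F
    simp only [one_smul] at h
    simp only [LinearMap.sum_apply, LinearMap.sub_apply]
    rw [h, zero_sub, neg_eq_zero]
    have h4 : ∀ i : Fin r, bra ε a (i : ℤ) (var i) (nlS ε a) F F =
        -bra ε a (i : ℤ) (nlS ε a) (var i) F F := fun i => bra_swap _ _ _ _ _ _
    simp only [h4, Finset.sum_neg_distrib, neg_eq_zero]
    simp only [bra_apply]
    rw [← map_sum, ← Finset.mul_sum, ← Dop_nlS]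
    exact bra_self ε a r (nlS ε a) F
  · have h := sum_bra_eq_zero ε a (fun _ _ => 1) (fun _ _ => rfl) (fun i j => (i : ℤ) + j - r - 1)
      (fun i j => by ring) F
    simp only [one_smul] at h
    simp only [LinearMap.sum_apply, LinearMap.sub_apply, LinearMap.add_apply]
    rw [h, bra_self]
    have h4 : ∀ i : Fin r, bra ε a ((i : ℤ) - 1) (var i) (nlS ε a) F F =
        -bra ε a ((i : ℤ) - 1) (nlS ε a) (var i) F F := fun i => bra_swap _ _ _ _ _ _
    simp only [h4, Finset.sum_neg_distrib]
    simp
  · rfl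

/-- The generalised bivector `P_m ∈ Γ̂²`, an alternating bilinear map `Λ² → Λ`, of the hierarchy
with parameters `a = (a_0, …, a_r)`; the number `ε` is the dispersion parameter. -/
def P (ε : ℝ) (a : Fin (r + 1) → ℝ) (m : ℕ) : Lam U [⋀^Fin 2]→ₗ[ℝ] Lam U where
  toFun F := Pform ε a m (F 0) (F 1)
  map_update_add' F i x y := by
    fin_cases i <;> simp [Function.update]
  map_update_smul' F i c x := by
    fin_cases i <;> simp [Function.update]
  map_eq_zero_of_eq' F i j h hij := by
    have : F 0 = F 1 := by
      fin_cases i <;> fin_cases j <;> first | exact absurd rfl hij | exact h | exact h.symm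
    rw [this]
    exact Pform_self ε a m _

/-- The leading term `P_m^{[0]}`: in `P_m`, which is a series in `ε`, put `ε = 0`. -/
def Plead (a : Fin (r + 1) → ℝ) (m : ℕ) : Lam U [⋀^Fin 2]→ₗ[ℝ] Lam U := P 0 a m

/-! ### Reciprocal transformations -/

/-- Transport of alternating maps along a linear isomorphism. -/
def push {Λ Λ' : Type*} [AddCommGroup Λ] [Module ℝ Λ] [AddCommGroup Λ'] [Module ℝ Λ']
    (e : Λ ≃ₗ[ℝ] Λ') (p : ℕ) (Q : Λ [⋀^Fin p]→ₗ[ℝ] Λ) : Λ' [⋀^Fin p]→ₗ[ℝ] Λ' :=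
  e.toLinearMap.compAlternatingMap (Q.compLinearMap e.symm.toLinearMap)

/-- `∂_y = ρ⁻¹ ∂_x`. -/
def dy (ρ : (DA U)ˣ) : DA U →ₗ[ℝ] DA U :=
  LinearMap.mulLeft ℝ ((ρ⁻¹ : (DA U)ˣ) : DA U) ∘ₗ (dx U).toLinearMap

/-- `Φ_0 : Λ_x → Λ_y`, `f + ∂_x 𝒜 ↦ ρ⁻¹ f + ∂_y 𝒜`. -/
def Phi0 (ρ : (DA U)ˣ) : Lam U ≃ₗ[ℝ] LamOf (dy ρ) :=
  Submodule.Quotient.equiv _ _ (ρ⁻¹.mulLeftLinearEquiv ℝ (DA U)) (by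
    rw [dy, LinearMap.range_comp]
    rfl)

/-- The reciprocal transformation `Φ_p : Γ̂^p_x → Γ̂^p_y` with respect to `ρ`:
`Φ_p(Q)(Y_1, …, Y_p) = Φ_0(Q(Φ_0⁻¹ Y_1, …, Φ_0⁻¹ Y_p))`. -/
def Phi (ρ : (DA U)ˣ) (p : ℕ) (Q : Lam U [⋀^Fin p]→ₗ[ℝ] Lam U) :
    LamOf (dy ρ) [⋀^Fin p]→ₗ[ℝ] LamOf (dy ρ) := push (Phi0 ρ) p Q

/-! ### The dispersionless reciprocal transformation -/

/-- The change of coordinates `v^{r-i} = w^i / w^0`, i.e. `v^i = w^{r-i} / w^0`. -/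
def rev (p : Fin r → ℝ) : Fin r → ℝ := fun i => coord p ((r : ℤ) - i) / coord p 0

lemma contDiffOn_rev (hU : ∀ p ∈ U, 0 < coord p 0) :
    ContDiffOn ℝ ∞ (rev : (Fin r → ℝ) → Fin r → ℝ) U :=
  contDiffOn_pi.2 fun _ => (contDiff_coord _).contDiffOn.div (contDiff_coord _).contDiffOn
    fun p hp => (hU p hp).ne'

/-- The invertible function `√w^0` on a domain where `w^0 > 0`. -/
def sqrtW (hU : ∀ p ∈ U, 0 < coord p 0) : (Sm U)ˣ where
  val := Sm.ofFun (fun p => √(coord p 0))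
    ((contDiff_coord 0).contDiffOn.sqrt fun p hp => (hU p hp).ne')
  inv := Sm.ofFun (fun p => (√(coord p 0))⁻¹)
    (((contDiff_coord 0).contDiffOn.sqrt fun p hp => (hU p hp).ne').inv
      fun p hp => (Real.sqrt_pos.2 (hU p hp)).ne')
  val_inv := Sm.ext fun p => mul_inv_cancel₀ (Real.sqrt_pos.2 (hU p p.2)).ne'
  inv_val := Sm.ext fun p => inv_mul_cancel₀ (Real.sqrt_pos.2 (hU p p.2)).ne'

/-- `ρ = √w^0 ∈ 𝒜`. This is `1 / c_0` in the dispersionless case, where `c_0² w^0 = 1`. -/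
def rho (hU : ∀ p ∈ U, 0 < coord p 0) : (DA U)ˣ := Units.map (cst (U := U)).toMonoidHom (sqrtW hU)

/-- `f ∘ rev ∈ C^∞(U)` for `f ∈ C^∞(V)`. -/
def pullFun (hU : ∀ p ∈ U, 0 < coord p 0) (h : Set.MapsTo rev (U : Set (Fin r → ℝ)) V)
    (f : Sm V) : Sm U :=
  Sm.ofFun (zeroExt f.val ∘ rev) ((contDiffOn_zeroExt f).comp (contDiffOn_rev hU) h)

lemma pullFun_val (hU : ∀ p ∈ U, 0 < coord p 0) (h : Set.MapsTo rev (U : Set (Fin r → ℝ)) V)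
    (f : Sm V) (p : U) : (pullFun hU h f).val p = f.val ⟨rev p, h p.2⟩ :=
  zeroExt_of_mem _ (h p.2)

/-- The algebra map `C^∞(V) → C^∞(U)`, `f ↦ f ∘ rev`. -/
def pull (hU : ∀ p ∈ U, 0 < coord p 0) (h : Set.MapsTo rev (U : Set (Fin r → ℝ)) V) :
    Sm V →ₐ[ℝ] Sm U where
  toFun := pullFun hU h
  map_one' := Sm.ext fun p => by rw [pullFun_val]; rfl
  map_zero' := Sm.ext fun p => by rw [pullFun_val]; rfl
  map_mul' f g := Sm.ext fun p => by
    rw [Sm.val_mul, Pi.mul_apply, pullFun_val, pullFun_val, pullFun_val]; rfl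
  map_add' f g := Sm.ext fun p => by
    rw [Sm.val_add, Pi.add_apply, pullFun_val, pullFun_val, pullFun_val]; rfl
  commutes' c := Sm.ext fun p => by rw [pullFun_val]; rfl

/-- `∂_y = ρ⁻¹ ∂_x`, `ρ = √w^0`, on differential polynomials. -/
def dyPol (hU : ∀ p ∈ U, 0 < coord p 0) : Derivation ℝ (DP U) (DP U) :=
  (MvPolynomial.C ((sqrtW hU)⁻¹ : (Sm U)ˣ).val : DP U) • totD U

/-- `v^i = w^{r-i} / w^0` as an element of `C^∞(U)`. -/
def vSm (hU : ∀ p ∈ U, 0 < coord p 0) (i : Fin r) : Sm U :=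
  Sm.ofFun (fun p => rev p i) (contDiffOn_pi.1 (contDiffOn_rev hU) i)

/-- The substitution of jets: a differential polynomial in the variables `v` (with respect to `y`)
is written in the variables `w` (with respect to `x`), by `f(v) ↦ f(rev w)` for `f ∈ C^∞(V)` and
`v^{i,s} ↦ ∂_y^s v^i`. -/
def subst (hU : ∀ p ∈ U, 0 < coord p 0) (h : Set.MapsTo rev (U : Set (Fin r → ℝ)) V) :
    DP V →ₐ[ℝ] DP U where
  __ := MvPolynomial.eval₂Hom (MvPolynomial.C.comp (pull hU h).toRingHom)
    fun v : Fin r × ℕ => (dyPol hU)^[v.2 + 1] (MvPolynomial.C (vSm hU v.1))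
  commutes' c := by
    simp [MvPolynomial.algebraMap_apply]

lemma subst_C (hU : ∀ p ∈ U, 0 < coord p 0) (h : Set.MapsTo rev (U : Set (Fin r → ℝ)) V)
    (c : Sm V) : subst hU h (MvPolynomial.C c) = MvPolynomial.C (pull hU h c) :=
  MvPolynomial.eval₂_C _ _ _

lemma subst_X (hU : ∀ p ∈ U, 0 < coord p 0) (h : Set.MapsTo rev (U : Set (Fin r → ℝ)) V)
    (v : Fin r × ℕ) : subst hU h (MvPolynomial.X v) =
      (dyPol hU)^[v.2 + 1] (MvPolynomial.C (vSm hU v.1)) :=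
  MvPolynomial.eval₂_X _ _ _

lemma dyPol_apply (hU : ∀ p ∈ U, 0 < coord p 0) (f : DP U) :
    dyPol hU f = MvPolynomial.C ((sqrtW hU)⁻¹ : (Sm U)ˣ).val * totD U f := rfl

lemma hom_dyPol (hU : ∀ p ∈ U, 0 < coord p 0) {d : ℕ} {f : DP U} (hf : Hom d f) :
    Hom (d + 1) (dyPol hU f) := by
  rw [dyPol_apply, ← zero_add (d + 1)]
  exact hom_mul (hom_C _) (hom_totD hf)

lemma hom_subst (hU : ∀ p ∈ U, 0 < coord p 0) (h : Set.MapsTo rev (U : Set (Fin r → ℝ)) V)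
    {d : ℕ} {f : DP V} (hf : Hom d f) : Hom d (subst hU h f) := by
  have hX : ∀ v : Fin r × ℕ, Hom (wt v) (subst hU h (MvPolynomial.X v)) := by
    intro v
    rw [subst_X]
    have : ∀ n, Hom n ((dyPol hU)^[n] (MvPolynomial.C (vSm hU v.1))) := by
      intro n
      induction n with
      | zero => exact hom_C _
      | succ n ih => rw [Function.iterate_succ_apply']; exact hom_dyPol hU ih
    exact this _
  rw [f.as_sum, map_sum]
  refine hom_sum _ _ fun n hn => ?_
  have hn' : Finsupp.weight wt n = d := hf (MvPolynomial.mem_support_iff.1 hn)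
  rw [MvPolynomial.monomial_eq, map_mul, subst_C, Finsupp.prod, map_prod, ← zero_add d]
  refine hom_mul (hom_C _) ?_
  rw [← hn', Finsupp.weight_apply, Finsupp.sum]
  refine MvPolynomial.IsWeightedHomogeneous.prod _ _ _ fun v _ => ?_
  rw [map_pow]
  exact (hX v).pow _

/-- Chain rule. -/
lemma pd_pull (hU : ∀ p ∈ U, 0 < coord p 0) (h : Set.MapsTo rev (U : Set (Fin r → ℝ)) V)
    (k : Fin r) (c : Sm V) :
    pd k (pull hU h c) = ∑ i : Fin r, pd k (vSm hU i) * pull hU h (pd i c) := by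
  have hval : ∀ (t : Finset (Fin r)) (g : Fin r → Sm U) (p : U),
      (∑ i ∈ t, g i).val p = ∑ i ∈ t, (g i).val p := by
    intro t g p
    induction t using Finset.induction_on with
    | empty => rfl
    | insert a t ha ih =>
      rw [Finset.sum_insert ha, Finset.sum_insert ha, Sm.val_add, Pi.add_apply, ih]
  refine Sm.ext fun p => ?_
  have hp : rev (p : Fin r → ℝ) ∈ V := h p.2
  have hc : DifferentiableAt ℝ (zeroExt c.val) (rev (p : Fin r → ℝ)) :=
    differentiableAt_zeroExt c ⟨_, hp⟩
  have hr : DifferentiableAt ℝ (rev : (Fin r → ℝ) → Fin r → ℝ) p :=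
    ((contDiffOn_rev hU).contDiffAt (U.isOpen.mem_nhds p.2)).differentiableAt (by simp)
  rw [pd_apply, hval]
  have h1 : zeroExt (pull hU h c).val =ᶠ[nhds (p : Fin r → ℝ)] zeroExt c.val ∘ rev :=
    zeroExt_ofFun_eventuallyEq _ ((contDiffOn_zeroExt c).comp (contDiffOn_rev hU) h) p
  rw [h1.fderiv_eq, fderiv_comp _ hc hr, ContinuousLinearMap.comp_apply]
  have h2 : ∀ i, (pd k (vSm hU i)).val p = fderiv ℝ rev (p : Fin r → ℝ) (Pi.single k 1) i := by
    intro i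
    have h3 : zeroExt (vSm hU i).val =ᶠ[nhds (p : Fin r → ℝ)] fun q => rev q i :=
      zeroExt_ofFun_eventuallyEq _ _ p
    rw [pd_apply, h3.fderiv_eq, fderiv_apply hr]
    rfl
  have h4 : ∀ i, (pull hU h (pd i c)).val p =
      fderiv ℝ (zeroExt c.val) (rev (p : Fin r → ℝ)) (Pi.single i 1) := by
    intro i
    refine (zeroExt_of_mem _ hp).trans ?_
    rfl
  set v := fderiv ℝ rev (p : Fin r → ℝ) (Pi.single k 1) with hv
  conv_lhs => rw [← Finset.univ_sum_single v, map_sum]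
  refine Finset.sum_congr rfl fun i _ => ?_
  rw [Sm.val_mul, Pi.mul_apply, h2, h4]
  have h5 : Pi.single i (v i) = (v i) • (Pi.single i 1 : Fin r → ℝ) := by
    rw [← Pi.single_smul, smul_eq_mul, mul_one]
  rw [h5, map_smul, smul_eq_mul]

/-- The substitution intertwines the total derivative in the variables `v` with `∂_y`. -/
lemma subst_totD (hU : ∀ p ∈ U, 0 < coord p 0) (h : Set.MapsTo rev (U : Set (Fin r → ℝ)) V)
    (f : DP V) : subst hU h (totD V f) = dyPol hU (subst hU h f) := by
  refine der_ext (d₁ := (subst hU h).toLinearMap ∘ₗ (totD V).toLinearMap)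
    (d₂ := (dyPol hU).toLinearMap ∘ₗ (subst hU h).toLinearMap) (subst hU h)
    (fun f g => ?_) (fun f g => ?_) (fun c => ?_) (fun v => ?_) f
  · simp [Derivation.leibniz]
  · simp [Derivation.leibniz]
  · change subst hU h (totD V (MvPolynomial.C c)) = dyPol hU (subst hU h (MvPolynomial.C c))
    rw [totD_C, map_sum, subst_C, dyPol_apply, totD_C]
    simp only [map_mul, subst_X, subst_C, pd_pull, zero_add, Function.iterate_one, dyPol_apply,
      totD_C, map_sum, Finset.mul_sum, Finset.sum_mul]
    rw [Finset.sum_comm]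
    refine Finset.sum_congr rfl fun i _ => Finset.sum_congr rfl fun k _ => ?_
    ring
  · change subst hU h (totD V (MvPolynomial.X v)) = dyPol hU (subst hU h (MvPolynomial.X v))
    rw [totD_X, subst_X, subst_X]
    exact Function.iterate_succ_apply' (dyPol hU) _ _

/-- The substitution of jets on the completed rings. -/
def substA (hU : ∀ p ∈ U, 0 < coord p 0) (h : Set.MapsTo rev (U : Set (Fin r → ℝ)) V) :
    DA V →ₗ[ℝ] DA U :=
  gradedMap (fun _ => (subst hU h).toLinearMap) fun _ _ hf => hom_subst hU h hf

lemma comp_substA (hU : ∀ p ∈ U, 0 < coord p 0) (h : Set.MapsTo rev (U : Set (Fin r → ℝ)) V)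
    (d : ℕ) (F : DA V) : comp d (substA hU h F) = subst hU h (comp d F) :=
  comp_gradedMap _ (fun _ _ hf => hom_subst hU h hf) d F

lemma substA_dx (hU : ∀ p ∈ U, 0 < coord p 0) (h : Set.MapsTo rev (U : Set (Fin r → ℝ)) V)
    (F : DA V) : substA hU h (dx V F) = dy (rho hU) (substA hU h F) := DA.ext fun d => by
  have h1 : ∀ (c : Sm U) (G : DA U) (d : ℕ),
      comp d (cst c * G) = MvPolynomial.C c * comp d G := by
    intro c G d
    rw [comp_mul, Finset.sum_eq_single (0, d)]
    · simp [cst]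
    · rintro ⟨x, y⟩ hxy hne
      have hx : x ≠ 0 := by
        rintro rfl
        have := (Finset.HasAntidiagonal.mem_antidiagonal.1 hxy)
        simp only [zero_add] at this
        exact hne (by rw [this])
      simp [cst, hx]
    · intro hn
      exact absurd (Finset.HasAntidiagonal.mem_antidiagonal.2 (by simp)) hn
  have h2 : dy (rho hU) (substA hU h F) =
      cst ((sqrtW hU)⁻¹ : (Sm U)ˣ).val * dx U (substA hU h F) := rfl
  rw [h2, h1, comp_substA]
  cases d with
  | zero => simp
  | succ d =>
    rw [comp_succ_dx, comp_succ_dx, comp_substA]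
    exact subst_totD hU h _

/-- Local functionals in the variables `v^i`, viewed as elements of `Λ_y`: the class of a density
`f(v, v_y, v_yy, …)` goes to its class in `𝒜 / ∂_y 𝒜`. -/
def toLamY (hU : ∀ p ∈ U, 0 < coord p 0) (h : Set.MapsTo rev (U : Set (Fin r → ℝ)) V) :
    Lam V →ₗ[ℝ] LamOf (dy (rho hU)) :=
  Submodule.mapQ _ _ (substA hU h) (by
    rintro _ ⟨F, rfl⟩
    exact ⟨substA hU h F, (substA_dx hU h F).symm⟩)

end RKdVCH

end

/-! At ε = 0 complete the variational derivatives θ_i = δF/δw^i (i < r) by θ_r = -S(F). The defining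
property of S becomes the linear constraint ∑_{j=0}^r 𝒟_j θ_j = 0 (`sum_Dop_extVar`), and all r + 3
structures, local or not, take the single form ∑_{i,j=0}^r f_m^{ij} ∫ θ_i 𝒟_{i+j+1-m} θ'_j
(`Pform_zero`).

In these variables the reciprocal transformation is just the reversal of indices. For corresponding
functionals ∫ f dy = ∫ ρ f dx one has ρ θ_i = θ̃_{r-i} (`sqrtW_mul_extVar`). Since also ρ² v^{r-k} =
w^k and ∂_x = ρ ∂_y, the density θ̃_{r-i} 𝒟̃_{r-k} θ̃'_{r-j} dy equals θ_i 𝒟_k θ'_j dx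
(`mul_Dop_subst`). Hence P̃_{r+2-m} is carried to the form with the same operators 𝒟_{i+j+1-m} but
with signs f_{r+2-m}^{r-i,r-j}. The sum of the two sign matrices is δ_{i,m-1} + δ_{j,m-1}
(`sgn_add_sgn`). In the row i = m - 1 the operator is 𝒟_j, so the constraint annihilates the row;
the column j = m - 1 follows by skew-adjointness (`sum_sgn_add_sgn`). This gives the minus sign of
the theorem.

The analytic input is the behaviour of variational derivatives under a change of the independent
variable that depends on the fields: besides the Jacobian ∂v^j/∂w^i there is a term (∂ρ/∂w^i) W(F)
(`eul_subst`). The Euler operator obeys no product rule, so the adjoint of the Fréchet derivative,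
with an extra argument h, is transformed instead: that identity is stable under sums, products and
the total derivative, hence can be proved by induction on f. -/

namespace RKdVCH

variable {r : ℕ} {U V : Opens (Fin r → ℝ)}

/-! ### The adjoint of the Fréchet derivative -/

/-- `∑_{0 ≤ b < N} (-∂_x)^b (h ∂f/∂w^{i,a+b})`. For `N` large and `a = 0` this is the adjoint of
the Fréchet derivative of `f` in the direction `w^i`, applied to `h`. -/
noncomputable def adjEul (i : Fin r) (a N : ℕ) (f h : DP U) : DP U :=
  ∑ b ∈ Finset.range N, ((-(totD U).toLinearMap) ^ b) (h * jetPD i (a + b) f)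

lemma adjEul_one (i : Fin r) (a N : ℕ) (f : DP U) : adjEul i a N f 1 = eul i a N f := by
  simp [adjEul, eul_apply]

lemma adjEul_add (i : Fin r) (a N : ℕ) (f g h : DP U) :
    adjEul i a N (f + g) h = adjEul i a N f h + adjEul i a N g h := by
  simp [adjEul, mul_add, Finset.sum_add_distrib]

/-- This is the purpose of the argument h: the Leibniz rule moves the other factor into h, which
makes induction over products possible. -/
lemma adjEul_mul (i : Fin r) (a N : ℕ) (f g h : DP U) :
    adjEul i a N (f * g) h = adjEul i a N f (g * h) + adjEul i a N g (f * h) := by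
  rw [adjEul, adjEul, adjEul, ← Finset.sum_add_distrib]
  refine Finset.sum_congr rfl fun b _ => ?_
  rw [← map_add, Derivation.leibniz, smul_eq_mul, smul_eq_mul]
  congr 1
  ring

lemma adjEul_zero_C (i : Fin r) {N : ℕ} (hN : 0 < N) (c : Sm U) (h : DP U) :
    adjEul i 0 N (MvPolynomial.C c) h = h * MvPolynomial.C (pd i c) := by
  obtain ⟨N, rfl⟩ := Nat.exists_eq_succ_of_ne_zero hN.ne'
  simp [adjEul, Finset.sum_range_succ', jetPD_succ_C, jetPD_zero_C]

lemma adjEul_succ_C (i : Fin r) (a N : ℕ) (c : Sm U) (h : DP U) :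
    adjEul i (a + 1) N (MvPolynomial.C c) h = 0 :=
  Finset.sum_eq_zero fun b _ => by rw [add_right_comm, jetPD_succ_C, mul_zero, map_zero]

/-- The Fréchet derivative of ∂_x f is ∂_x composed with that of f, and the adjoint of ∂_x is -∂_x.
The last term is the error of truncating at N; it vanishes once N exceeds the order of f. -/
lemma adjEul_zero_totD (i : Fin r) (N : ℕ) (f h : DP U) :
    adjEul i 0 (N + 1) (totD U f) h = -adjEul i 0 (N + 1) f (totD U h) +
      ((-(totD U).toLinearMap) ^ N) (totD U (h * jetPD i N f)) := by
  rw [adjEul, adjEul]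
  induction N with
  | zero =>
    simp only [zero_add, Finset.sum_range_one, pow_zero, Module.End.one_apply,
      jetPD_zero_totD, Derivation.leibniz, smul_eq_mul]
    ring
  | succ N ih =>
    rw [Finset.sum_range_succ, ih, Finset.sum_range_succ _ (N + 1), zero_add, jetPD_succ_totD,
      mul_add, map_add, negD_pow_succ N (h * jetPD i N f), Derivation.leibniz, Derivation.leibniz]
    simp only [smul_eq_mul, map_add, mul_comm (jetPD i _ f)]
    ring

/-- For the higher operators the commutator [∂/∂w^{i,s+1}, ∂_x] = ∂/∂w^{i,s} makes the sum
telescope; it leaves the lowest term h ∂f/∂w^{i,a} and a truncation error. -/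
lemma adjEul_succ_totD (i : Fin r) (a N : ℕ) (f h : DP U) :
    adjEul i (a + 1) N (totD U f) h = h * jetPD i a f - adjEul i (a + 1) N f (totD U h) -
      ((-(totD U).toLinearMap) ^ N) (h * jetPD i (a + N) f) := by
  rw [adjEul, adjEul]
  induction N with
  | zero => simp
  | succ N ih =>
    have h1 : ((-(totD U).toLinearMap) ^ (N + 1)) (h * jetPD i (a + N + 1) f) =
        -(((-(totD U).toLinearMap) ^ N) (h * totD U (jetPD i (a + N + 1) f)) +
          ((-(totD U).toLinearMap) ^ N) (totD U h * jetPD i (a + N + 1) f)) := by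
      rw [negD_pow_succ, Derivation.leibniz, map_add, smul_eq_mul, smul_eq_mul,
        mul_comm (jetPD i _ f)]
    have h2 : ((-(totD U).toLinearMap) ^ N) (h * jetPD i (a + N + 1) (totD U f)) =
        ((-(totD U).toLinearMap) ^ N) (h * totD U (jetPD i (a + N + 1) f)) +
          ((-(totD U).toLinearMap) ^ N) (h * jetPD i (a + N) f) := by
      rw [jetPD_succ_totD, mul_add, map_add]
    rw [Finset.sum_range_succ, ih, Finset.sum_range_succ, show a + 1 + N = a + N + 1 by ring,
      ← add_assoc a, h1, h2]
    ring

/-! ### Truncation for large N without homogeneity -/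

lemma eventually_jetPD_eq_zero (f : DP U) :
    ∀ᶠ N in Filter.atTop, ∀ (i : Fin r) (s : ℕ), N ≤ s → jetPD i s f = 0 := by
  -- The variable with index (i, s) is w^{i,s+1}, so the order of f is at most one more than the
  -- supremum, and derivatives vanish from the supremum plus 2 on.
  refine Filter.eventually_atTop.2 ⟨f.vars.sup (fun v => v.2) + 2, fun N hN i s hs => ?_⟩
  obtain ⟨s, rfl⟩ : ∃ t, s = t + 1 := ⟨s - 1, by omega⟩
  refine MvPolynomial.pderiv_eq_zero_of_notMem_vars fun hv => ?_
  have := Finset.le_sup (f := fun v : Fin r × ℕ => v.2) hv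
  simp only at this
  omega

lemma eventually_totD_eq_sum (f : DP U) : ∀ᶠ N in Filter.atTop,
    totD U f = ∑ i : Fin r, ∑ s ∈ Finset.range N, MvPolynomial.X (i, s) * jetPD i s f := by
  induction f using MvPolynomial.induction_on with
  | C c =>
    filter_upwards [Filter.eventually_gt_atTop 0] with N hN
    obtain ⟨N, rfl⟩ := Nat.exists_eq_succ_of_ne_zero hN.ne'
    simp [totD_C, Finset.sum_range_succ', jetPD_succ_C, jetPD_zero_C]
  | add p q hp hq =>
    filter_upwards [hp, hq] with N hp hq
    simp only [map_add, mul_add, Finset.sum_add_distrib, ← hp, ← hq]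
  | mul_X p v hp =>
    filter_upwards [hp, Filter.eventually_gt_atTop (v.2 + 1)] with N hp hv
    have hX : totD U (MvPolynomial.X v) = ∑ i : Fin r, ∑ s ∈ Finset.range N,
        (MvPolynomial.X (i, s) : DP U) * jetPD i s (MvPolynomial.X v) := by
      obtain ⟨j, t⟩ := v
      simp only at hv
      rw [totD_X, Finset.sum_eq_single j, Finset.sum_eq_single (t + 1)]
      · simp [jetPD_succ_X]
      · intro s _ hs
        cases s with
        | zero => rw [jetPD_zero_X, mul_zero]
        | succ s => rw [jetPD_succ_X, if_neg (by simpa using fun h => hs (by omega)), mul_zero]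
      · intro h; exact absurd (Finset.mem_range.2 hv) h
      · intro i _ hi
        refine Finset.sum_eq_zero fun s _ => ?_
        cases s with
        | zero => rw [jetPD_zero_X, mul_zero]
        | succ s => rw [jetPD_succ_X, if_neg (by simp [Ne.symm hi]), mul_zero]
      · intro h; exact absurd (Finset.mem_univ _) h
    simp only [Derivation.leibniz, smul_eq_mul, hp, hX, mul_add, Finset.sum_add_distrib,
      Finset.mul_sum, mul_left_comm p, mul_left_comm (MvPolynomial.X v)]

/-- The bilinear form `M_N(f, h) = ∑_i ∑_{0 ≤ a < N} w^{i,a+1} ∑_b (-∂_x)^b (h ∂f/∂w^{i,a+b+1})`;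
for `N` large, `f - M_N(f, 1) = W(f)`. -/
noncomputable def adjW (N : ℕ) (f h : DP U) : DP U :=
  ∑ i : Fin r, ∑ a ∈ Finset.range N, MvPolynomial.X (i, a) * adjEul i (a + 1) N f h

lemma adjW_add (N : ℕ) (f g h : DP U) : adjW N (f + g) h = adjW N f h + adjW N g h := by
  simp [adjW, adjEul_add, mul_add, Finset.sum_add_distrib]

lemma adjW_mul (N : ℕ) (f g h : DP U) :
    adjW N (f * g) h = adjW N f (g * h) + adjW N g (f * h) := by
  simp [adjW, adjEul_mul, mul_add, Finset.sum_add_distrib]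

lemma adjW_C (N : ℕ) (c : Sm U) (h : DP U) : adjW N (MvPolynomial.C c) h = 0 := by
  simp [adjW, adjEul_succ_C]

lemma eventually_adjEul_totD (f : DP U) : ∀ᶠ N in Filter.atTop, ∀ (i : Fin r) (h : DP U),
    adjEul i 0 N (totD U f) h = -adjEul i 0 N f (totD U h) := by
  obtain ⟨N₀, h0⟩ := Filter.eventually_atTop.1 (eventually_jetPD_eq_zero f)
  filter_upwards [Filter.eventually_gt_atTop N₀] with N hN i h
  obtain ⟨N, rfl⟩ : ∃ t, N = t + 1 := ⟨N - 1, by omega⟩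
  rw [adjEul_zero_totD, h0 N₀ le_rfl i N (by omega)]
  simp

/-- The lowest terms left by `adjEul_succ_totD`, weighted by w^{i,a+1}, add up to h ∂_x f. -/
lemma eventually_adjW_totD (f : DP U) : ∀ᶠ N in Filter.atTop, ∀ h : DP U,
    adjW N (totD U f) h = h * totD U f - adjW N f (totD U h) := by
  filter_upwards [eventually_jetPD_eq_zero f, eventually_totD_eq_sum f] with N h0 h1 h
  rw [h1, ← h1, adjW, adjW]
  conv_rhs => rw [h1]
  simp only [Finset.mul_sum, ← Finset.sum_sub_distrib]
  refine Finset.sum_congr rfl fun i _ => Finset.sum_congr rfl fun a _ => ?_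
  rw [adjEul_succ_totD, h0 i (a + N) (by omega), mul_zero, map_zero]
  ring

lemma adjW_one {d N : ℕ} {f : DP U} (hf : Hom d f) (hN : d < N) :
    adjW N f 1 = f - WComp d f := by
  rw [WComp_apply, sub_sub_cancel, adjW]
  refine Finset.sum_congr rfl fun i _ => ?_
  refine (Finset.sum_subset (Finset.range_mono hN.le) fun a _ ha => ?_).symm.trans ?_
  · have ha' : d ≤ a := not_lt.1 fun h => ha (Finset.mem_range.2 h)
    rw [adjEul_one, eul_apply, Finset.sum_eq_zero, mul_zero]
    intro b _
    rw [jetPD_eq_zero i hf (by omega), map_zero]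
  · refine Finset.sum_congr rfl fun a _ => ?_
    rw [adjEul_one, eul_stable i (a + 1) hf (by omega) (show d + 1 ≤ N by omega)]

/-- A homogeneous differential polynomial of positive degree with vanishing total derivative is
zero. -/
lemma eq_zero_of_totD_eq_zero {d : ℕ} (hd : 0 < d) {f : DP U} (hf : Hom d f)
    (h : totD U f = 0) : f = 0 := by
  -- Descending induction on s: with ∂_x f = 0 the commutator relation reads ∂f/∂w^{i,s} =
  -- -∂_x(∂f/∂w^{i,s+1}), and the right side vanishes for s ≥ d.
  have h1 : ∀ n s (i : Fin r), d < s + n → jetPD i s f = 0 := by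
    intro n
    induction n with
    | zero => exact fun s i hs => jetPD_eq_zero i hf (by simpa using hs)
    | succ n ih =>
      intro s i hs
      have := jetPD_succ_totD i s f
      rw [h, map_zero, ih (s + 1) i (by omega), map_zero, zero_add] at this
      exact this.symm
  refine MvPolynomial.ext _ _ fun n => ?_
  by_contra hn
  have hw : Finsupp.weight wt n = d := hf hn
  have hn0 : n ≠ 0 := by
    rintro rfl
    simp at hw
    omega
  obtain ⟨⟨i, s⟩, hv⟩ := Finsupp.ne_iff.1 hn0
  have h2 : MvPolynomial.pderiv (i, s) f = 0 := h1 (d + 1) (s + 1) i (by omega)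
  have h3 := congrArg (MvPolynomial.coeff (n - Finsupp.single (i, s) 1)) h2
  rw [MvPolynomial.coeff_pderiv] at h3
  have h4 : n - Finsupp.single (i, s) 1 + Finsupp.single (i, s) 1 = n :=
    tsub_add_cancel_of_le (Finsupp.single_le_iff.2 (Nat.one_le_iff_ne_zero.2 hv))
  rw [h4, MvPolynomial.coeff_zero] at h3
  -- The exponent produced by differentiation is a positive real scalar, hence can be cancelled
  -- although the coefficient ring may have zero divisors.
  have h5 : ((n - Finsupp.single (i, s) 1 : Fin r × ℕ →₀ ℕ) (i, s) : Sm U) + 1 =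
      algebraMap ℝ (Sm U) (((n - Finsupp.single (i, s) 1 : Fin r × ℕ →₀ ℕ) (i, s) : ℝ) + 1) := by
    simp
  rw [h5, mul_comm, ← Algebra.smul_def] at h3
  refine hn ?_
  rw [MvPolynomial.coeff_zero]
  exact (smul_eq_zero.1 h3).resolve_left (by positivity)

/-! ### Transformation of variational derivatives -/

/-- Jet variables arise from coordinate functions by total derivatives, so a property of functions
that is stable under ∂_x holds for all jet variables. -/
lemma X_eq_iterate_totD (i : Fin r) (s : ℕ) : (MvPolynomial.X (i, s) : DP U) =
    (totD U)^[s + 1] (MvPolynomial.C (wSm U (i : ℤ))) := by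
  induction s with
  | zero => simp [totD_C, pd_wSm, apply_ite (MvPolynomial.C (σ := Fin r × ℕ) (R := Sm U))]
  | succ s ih => rw [Function.iterate_succ_apply', ← ih, totD_X]

/-- The transformation of the adjoint of the Fréchet derivative of `f` under the substitution of
jets. -/
def AdjEulSubst (hU : ∀ p ∈ U, 0 < coord p 0) (h : Set.MapsTo rev (U : Set (Fin r → ℝ)) V)
    (f : DP V) : Prop :=
  ∀ᶠ N in Filter.atTop, ∀ (i : Fin r) (k : DP V),
    adjEul i 0 N (subst hU h f) (MvPolynomial.C (sqrtW hU).val * subst hU h k) =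
      MvPolynomial.C (sqrtW hU).val *
        ∑ j : Fin r, subst hU h (adjEul j 0 N f k) * MvPolynomial.C (pd i (vSm hU j)) -
      MvPolynomial.C (pd i (sqrtW hU).val) * subst hU h (adjW N f k)

lemma adjEulSubst_C (hU : ∀ p ∈ U, 0 < coord p 0)
    (h : Set.MapsTo rev (U : Set (Fin r → ℝ)) V) (c : Sm V) :
    AdjEulSubst hU h (MvPolynomial.C c) := by
  filter_upwards [Filter.eventually_gt_atTop 0] with N hN i k
  simp only [subst_C, adjEul_zero_C _ hN, adjW_C, map_zero, mul_zero, sub_zero, pd_pull, map_sum,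
    map_mul, Finset.mul_sum]
  exact Finset.sum_congr rfl fun j _ => by ring

/-- The substitution turns ∂_y f into ρ⁻¹ ∂_x f. Differentiating the factor ρ⁻¹ gives a term in
∂ρ/∂w^i, and this is matched by the term k ∂_y f in `eventually_adjW_totD`. The weight ρ on the test
function accounts for dy = ρ dx: it cancels ρ⁻¹, and ∂_x k = ρ ∂_y k restores it. -/
lemma adjEulSubst_totD {hU : ∀ p ∈ U, 0 < coord p 0}
    {h : Set.MapsTo rev (U : Set (Fin r → ℝ)) V} {f : DP V} (hf : AdjEulSubst hU h f) :
    AdjEulSubst hU h (totD V f) := by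
  have hinv : MvPolynomial.C ((sqrtW hU)⁻¹ : (Sm U)ˣ).val * MvPolynomial.C (sqrtW hU).val =
      (1 : DP U) := by
    rw [← map_mul, Units.inv_mul, map_one]
  filter_upwards [hf, eventually_adjEul_totD f, eventually_adjW_totD f,
    eventually_adjEul_totD (subst hU h f), Filter.eventually_gt_atTop 0] with N hf h1 h2 h3 hN i k
  have h4 : pd i ((sqrtW hU)⁻¹ : (Sm U)ˣ).val * (sqrtW hU).val =
      -(((sqrtW hU)⁻¹ : (Sm U)ˣ).val * pd i (sqrtW hU).val) := by
    have := congrArg (pd i) (Units.inv_mul (sqrtW hU))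
    rw [Derivation.leibniz, Derivation.map_one_eq_zero, smul_eq_mul, smul_eq_mul] at this
    linear_combination this
  have h4' := congrArg (MvPolynomial.C (σ := Fin r × ℕ)) h4
  rw [map_neg, map_mul, map_mul] at h4'
  have h5 : ∀ g : DP U, MvPolynomial.C ((sqrtW hU)⁻¹ : (Sm U)ˣ).val *
      (MvPolynomial.C (sqrtW hU).val * g) = g := fun g => by rw [← mul_assoc, hinv, one_mul]
  have h6 : totD U (subst hU h k) = MvPolynomial.C (sqrtW hU).val * subst hU h (totD V k) := by
    rw [subst_totD, dyPol_apply]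
    linear_combination (-totD U (subst hU h k)) * hinv
  have h7 : totD U (subst hU h f) = MvPolynomial.C (sqrtW hU).val * subst hU h (totD V f) := by
    rw [subst_totD, dyPol_apply]
    linear_combination (-totD U (subst hU h f)) * hinv
  conv_lhs => rw [subst_totD, dyPol_apply]
  rw [adjEul_mul, adjEul_zero_C _ hN, h5, h3, h6, hf, h2]
  simp only [h1, map_neg, map_sub, map_mul, neg_mul, Finset.sum_neg_distrib]
  rw [h7]
  linear_combination (MvPolynomial.C (sqrtW hU).val * subst hU h (totD V f) * subst hU h k) * h4'
    - (subst hU h (totD V f) * subst hU h k * MvPolynomial.C (pd i (sqrtW hU).val)) * hinv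

lemma adjEulSubst (hU : ∀ p ∈ U, 0 < coord p 0)
    (h : Set.MapsTo rev (U : Set (Fin r → ℝ)) V) (f : DP V) : AdjEulSubst hU h f := by
  induction f using MvPolynomial.induction_on with
  | C c => exact adjEulSubst_C hU h c
  | add p q hp hq =>
    filter_upwards [hp, hq] with N hp hq i k
    simp only [map_add, adjEul_add, adjW_add, hp, hq, add_mul, Finset.sum_add_distrib]
    ring
  | mul_X p v hp =>
    -- A jet variable is reached from a coordinate function by iterating the stability under ∂_y.
    have hv : AdjEulSubst hU h (MvPolynomial.X v) := by
      rw [← Prod.eta v, X_eq_iterate_totD]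
      induction v.2 + 1 with
      | zero => exact adjEulSubst_C hU h _
      | succ n ih => rw [Function.iterate_succ_apply']; exact adjEulSubst_totD ih
    filter_upwards [hp, hv] with N hp hv i k
    rw [map_mul, adjEul_mul, mul_left_comm, ← map_mul, hp, mul_left_comm, ← map_mul, hv, adjW_mul]
    simp only [adjEul_mul, map_add, add_mul, Finset.sum_add_distrib]
    ring

/-- Take k = 1. The density in x is ρ f, so the product rule adds (∂ρ/∂w^i) f to the term -(∂ρ/∂w^i)
M_N(f, 1) already present, and f - M_N(f, 1) = W(f). -/
lemma eul_subst (hU : ∀ p ∈ U, 0 < coord p 0) (h : Set.MapsTo rev (U : Set (Fin r → ℝ)) V)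
    (i : Fin r) {d : ℕ} {f : DP V} (hf : Hom d f) :
    eul i 0 (d + 1) (MvPolynomial.C (sqrtW hU).val * subst hU h f) =
      MvPolynomial.C (sqrtW hU).val *
        ∑ j : Fin r, subst hU h (eul j 0 (d + 1) f) * MvPolynomial.C (pd i (vSm hU j)) +
      MvPolynomial.C (pd i (sqrtW hU).val) * subst hU h (WComp d f) := by
  obtain ⟨N, hN, hdN⟩ :=
    ((adjEulSubst hU h f).and (Filter.eventually_gt_atTop d)).exists
  have h0 : Hom d (MvPolynomial.C (sqrtW hU).val * subst hU h f) := by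
    simpa using hom_mul (hom_C (sqrtW hU).val) (hom_subst hU h hf)
  have h1 := hN i 1
  rw [map_one, mul_one] at h1
  rw [← eul_stable i 0 h0 (by omega) (show d + 1 ≤ N by omega), ← adjEul_one, adjEul_mul,
    adjEul_zero_C i (by omega), mul_one, mul_one, h1, adjW_one hf hdN]
  simp only [adjEul_one, eul_stable _ 0 hf (show d < 0 + (d + 1) by omega)
    (show d + 1 ≤ N by omega), map_sub]
  ring

/-! ### Passage to the completed ring -/

/-- ∂_x is injective in positive degrees. This characterises W(F), which is given by its derivative
and its component of degree 0. -/
lemma DA.ext_of_dx {F G : DA U} (h0 : comp 0 F = comp 0 G) (h : dx U F = dx U G) : F = G := by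
  refine DA.ext fun d => ?_
  rcases Nat.eq_zero_or_pos d with rfl | hd
  · exact h0
  · refine sub_eq_zero.1 (eq_zero_of_totD_eq_zero hd (hom_sub (hom_comp d F) (hom_comp d G)) ?_)
    rw [map_sub, ← comp_succ_dx, ← comp_succ_dx, h, sub_self]

lemma comp_cst_mul (c : Sm U) (G : DA U) (d : ℕ) :
    comp d (cst c * G) = MvPolynomial.C c * comp d G := by
  rw [comp_mul, Finset.sum_eq_single (0, d)]
  · simp [cst]
  · rintro ⟨x, y⟩ hxy hne
    have hx : x ≠ 0 := by
      rintro rfl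
      have := Finset.HasAntidiagonal.mem_antidiagonal.1 hxy
      simp only [zero_add] at this
      exact hne (by rw [this])
    simp [cst, hx]
  · intro hn
    exact absurd (Finset.HasAntidiagonal.mem_antidiagonal.2 (by simp)) hn

lemma comp_cst (c : Sm U) (d : ℕ) :
    comp d (cst c) = if d = 0 then MvPolynomial.C c else (0 : DP U) := by
  simp [cst]

lemma substA_mul (hU : ∀ p ∈ U, 0 < coord p 0) (h : Set.MapsTo rev (U : Set (Fin r → ℝ)) V)
    (F G : DA V) : substA hU h (F * G) = substA hU h F * substA hU h G := DA.ext fun d => by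
  simp only [comp_substA, comp_mul, map_sum, map_mul]

lemma substA_cst (hU : ∀ p ∈ U, 0 < coord p 0) (h : Set.MapsTo rev (U : Set (Fin r → ℝ)) V)
    (c : Sm V) : substA hU h (cst c) = cst (pull hU h c) := DA.ext fun d => by
  rw [comp_substA, comp_cst, comp_cst]
  split_ifs
  · exact subst_C hU h c
  · exact map_zero _

lemma dx_cst (c : Sm U) : dx U (cst c) = ∑ i : Fin r, dx U (w U (i : ℤ)) * cst (pd i c) :=
  DA.ext fun d => by
    cases d with
    | zero => simp [comp_mul]
    | succ d =>
      rw [map_sum, comp_succ_dx, comp_cst]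
      simp only [comp_dx_w_mul, comp_cst]
      split_ifs
      · exact totD_C c
      · simp

lemma varA_subst (hU : ∀ p ∈ U, 0 < coord p 0) (h : Set.MapsTo rev (U : Set (Fin r → ℝ)) V)
    (i : Fin r) (F : DA V) :
    varA i (cst (sqrtW hU).val * substA hU h F) =
      cst (sqrtW hU).val * ∑ j : Fin r, cst (pd i (vSm hU j)) * substA hU h (varA j F) +
        cst (pd i (sqrtW hU).val) * substA hU h (WA F) := DA.ext fun d => by
  rw [map_add, comp_cst_mul, comp_cst_mul, varA, comp_gradedMap, comp_cst_mul, map_sum]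
  simp only [comp_cst_mul, comp_substA]
  rw [eul_subst hU h i (hom_comp d F), WA, comp_gradedMap]
  simp only [varA, comp_gradedMap, mul_comm (MvPolynomial.C (pd i (vSm hU _)))]

/-! ### The coordinate change as an involution -/

lemma coord_top (p : Fin r → ℝ) : coord p r = 1 := by
  rw [coord, dif_neg (by omega), if_pos rfl]

lemma coord_eq_zero (p : Fin r → ℝ) {k : ℤ} (hk : k < 0 ∨ (r : ℤ) < k) : coord p k = 0 := by
  rw [coord, dif_neg (by omega), if_neg (by omega)]

/-- The conventions w^r = 1 and w^k = 0 outside 0 ≤ k ≤ r are preserved by k ↦ r - k followed by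
division by w^0, so the formula needs no restriction on k. -/
lemma coord_rev {p : Fin r → ℝ} (hp : 0 < coord p 0) (k : ℤ) :
    coord (rev p) k = coord p (r - k) / coord p 0 := by
  rcases lt_or_ge k 0 with h0 | h0
  · rw [coord_eq_zero _ (.inl h0), coord_eq_zero _ (.inr (by omega)), zero_div]
  rcases lt_trichotomy k r with h1 | rfl | h1
  · lift k to ℕ using h0
    have hk : k < r := by omega
    exact (coord_fin (rev p) ⟨k, hk⟩)
  · rw [coord_top, sub_self, div_self hp.ne']
  · rw [coord_eq_zero _ (.inr h1), coord_eq_zero _ (.inl (by omega)), zero_div]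

lemma coord_rev_zero_pos {p : Fin r → ℝ} (hp : 0 < coord p 0) :
    0 < coord (rev p) 0 := by
  rw [coord_rev hp, sub_zero, coord_top]
  positivity

lemma rev_rev {p : Fin r → ℝ} (hp : 0 < coord p 0) : rev (rev p) = p := by
  funext i
  rw [rev, coord_rev hp, coord_rev hp, sub_sub_cancel, sub_zero, coord_top,
    div_div_div_cancel_right₀ hp.ne', div_one, coord_fin]

lemma vSm_eq_pull (hU : ∀ p ∈ U, 0 < coord p 0) (h : Set.MapsTo rev (U : Set (Fin r → ℝ)) V)
    (j : Fin r) : vSm hU j = pull hU h (wSm V (j : ℤ)) := Sm.ext fun p => by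
  refine Eq.trans ?_ (pullFun_val hU h _ p).symm
  exact (coord_fin (rev (p : Fin r → ℝ)) j).symm

lemma sqrtW_mul_self (hU : ∀ p ∈ U, 0 < coord p 0) :
    (sqrtW hU).val * (sqrtW hU).val = wSm U 0 :=
  Sm.ext fun p => Real.mul_self_sqrt (hU p p.2).le

lemma wSm_zero_mul_pull (hU : ∀ p ∈ U, 0 < coord p 0)
    (h : Set.MapsTo rev (U : Set (Fin r → ℝ)) V) (k : ℤ) :
    wSm U 0 * pull hU h (wSm V k) = wSm U (r - k) := Sm.ext fun p => by
  have hp := hU p p.2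
  have h1 : (pull hU h (wSm V k)).val p = coord (p : Fin r → ℝ) (r - k) / coord (p : Fin r → ℝ) 0 :=
    (pullFun_val hU h _ p).trans (coord_rev hp k)
  rw [Sm.val_mul, Pi.mul_apply, h1]
  exact mul_div_cancel₀ _ hp.ne'

lemma sqrtW_mul_dx_subst (hU : ∀ p ∈ U, 0 < coord p 0)
    (h : Set.MapsTo rev (U : Set (Fin r → ℝ)) V) (F : DA V) :
    cst (sqrtW hU).val * substA hU h (dx V F) = dx U (substA hU h F) := by
  rw [substA_dx]
  change cst (sqrtW hU).val * (cst ((sqrtW hU)⁻¹ : (Sm U)ˣ).val * _) = _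
  rw [← mul_assoc, ← map_mul, Units.mul_inv, map_one, one_mul]
  rfl

/-- The derivatives agree: by the chain rule ∑_i w^i_x times the transformed variational derivatives
is ρ ∂_x W̃ + ρ_x W̃ = ∂_x(ρ W̃). In degree 0 the operator W is the identity. -/
lemma WA_subst (hU : ∀ p ∈ U, 0 < coord p 0) (h : Set.MapsTo rev (U : Set (Fin r → ℝ)) V)
    (F : DA V) : WA (cst (sqrtW hU).val * substA hU h F) =
      cst (sqrtW hU).val * substA hU h (WA F) := by
  refine DA.ext_of_dx ?_ ?_
  · simp [WA, comp_cst_mul, comp_substA, WComp_apply]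
  · have h1 : dx U (substA hU h (WA F)) =
        ∑ j : Fin r, dx U (cst (vSm hU j)) * substA hU h (varA j F) := by
      rw [← sqrtW_mul_dx_subst, dx_WA, map_sum, Finset.mul_sum]
      refine Finset.sum_congr rfl fun j _ => ?_
      rw [substA_mul, ← mul_assoc, sqrtW_mul_dx_subst, w, substA_cst, vSm_eq_pull hU h]
    rw [dx_WA, Derivation.leibniz, smul_eq_mul, smul_eq_mul, h1, dx_cst (sqrtW hU).val]
    simp only [varA_subst, dx_cst (vSm hU _), mul_add, Finset.sum_add_distrib, Finset.mul_sum,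
      Finset.sum_mul]
    rw [Finset.sum_comm]
    refine congrArg₂ (· + ·) ?_ ?_
    · exact Finset.sum_congr rfl fun j _ => Finset.sum_congr rfl fun i _ => by ring
    · exact Finset.sum_congr rfl fun i _ => by ring

/-! ### Bijectivity of the identification of local functionals -/

lemma pull_sqrtW_inv (hU : ∀ p ∈ U, 0 < coord p 0) (hV : ∀ p ∈ V, 0 < coord p 0)
    (h : Set.MapsTo rev (U : Set (Fin r → ℝ)) V) :
    pull hU h ((sqrtW hV)⁻¹ : (Sm V)ˣ).val = (sqrtW hU).val := Sm.ext fun p => by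
  have h1 : (pull hU h ((sqrtW hV)⁻¹ : (Sm V)ˣ).val).val p =
      (√(coord (rev (p : Fin r → ℝ)) 0))⁻¹ := pullFun_val hU h _ p
  rw [h1, coord_rev (hU p p.2), sub_zero, coord_top, one_div, Real.sqrt_inv, inv_inv]
  rfl

lemma pull_pull (hU : ∀ p ∈ U, 0 < coord p 0) (hV : ∀ p ∈ V, 0 < coord p 0)
    (h : Set.MapsTo rev (U : Set (Fin r → ℝ)) V) (h' : Set.MapsTo rev (V : Set (Fin r → ℝ)) U)
    (c : Sm U) : pull hU h (pull hV h' c) = c := Sm.ext fun p => by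
  refine (pullFun_val hU h _ p).trans ((pullFun_val hV h' c _).trans ?_)
  exact congrArg c.val (Subtype.ext (rev_rev (hU p p.2)))

/-- Since v^0 = 1/w^0, the factor of the reciprocal transformation in the opposite direction is √v^0
= ρ⁻¹, so that it recovers ∂_x from ∂_y. -/
lemma subst_dyPol (hU : ∀ p ∈ U, 0 < coord p 0) (hV : ∀ p ∈ V, 0 < coord p 0)
    (h : Set.MapsTo rev (U : Set (Fin r → ℝ)) V) (f : DP V) :
    subst hU h (dyPol hV f) = totD U (subst hU h f) := by
  rw [dyPol_apply, map_mul, subst_C, pull_sqrtW_inv hU hV h, subst_totD, dyPol_apply, ← mul_assoc,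
    ← map_mul, Units.mul_inv, map_one, one_mul]

lemma subst_subst (hU : ∀ p ∈ U, 0 < coord p 0) (hV : ∀ p ∈ V, 0 < coord p 0)
    (h : Set.MapsTo rev (U : Set (Fin r → ℝ)) V) (h' : Set.MapsTo rev (V : Set (Fin r → ℝ)) U)
    (f : DP U) : subst hU h (subst hV h' f) = f := by
  induction f using MvPolynomial.induction_on with
  | C c => rw [subst_C, subst_C, pull_pull]
  | add p q hp hq => rw [map_add, map_add, hp, hq]
  | mul_X p v hp =>
    have key : ∀ (n : ℕ) (g : DP V), subst hU h ((dyPol hV)^[n] g) =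
        (totD U)^[n] (subst hU h g) := fun n =>
      Function.Semiconj.iterate_right (subst_dyPol hU hV h) n
    rw [map_mul, map_mul, hp, subst_X, key, subst_C, vSm_eq_pull hV h', pull_pull,
      ← X_eq_iterate_totD]

lemma substA_substA (hU : ∀ p ∈ U, 0 < coord p 0) (hV : ∀ p ∈ V, 0 < coord p 0)
    (h : Set.MapsTo rev (U : Set (Fin r → ℝ)) V) (h' : Set.MapsTo rev (V : Set (Fin r → ℝ)) U)
    (F : DA U) : substA hU h (substA hV h' F) = F := DA.ext fun d => by
  rw [comp_substA, comp_substA, subst_subst]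

lemma toLamY_bijective (hU : ∀ p ∈ U, 0 < coord p 0)
    (hV : Set.BijOn rev (U : Set (Fin r → ℝ)) (V : Set (Fin r → ℝ))) :
    Function.Bijective (toLamY hU hV.mapsTo) := by
  have hV0 : ∀ p ∈ V, 0 < coord p 0 := by
    intro p hp
    obtain ⟨q, hq, rfl⟩ := hV.surjOn hp
    exact coord_rev_zero_pos (hU q hq)
  have h' : Set.MapsTo rev (V : Set (Fin r → ℝ)) U := by
    intro p hp
    obtain ⟨q, hq, rfl⟩ := hV.surjOn hp
    rwa [rev_rev (hU q hq)]
  constructor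
  · rw [← LinearMap.ker_eq_bot, eq_bot_iff]
    intro F hF
    obtain ⟨f, rfl⟩ := Submodule.Quotient.mk_surjective _ F
    obtain ⟨g, hg⟩ := (Submodule.Quotient.mk_eq_zero _).1 (LinearMap.mem_ker.1 hF)
    -- If the substituted density is ∂_y g, then the original one is the total derivative of g
    -- rewritten by the inverse substitution.
    refine (Submodule.Quotient.mk_eq_zero _).2 ⟨substA hV0 h' g, ?_⟩
    rw [← substA_substA hV0 hU h' hV.mapsTo f, ← hg, ← substA_substA hU hV0 hV.mapsTo h' g,
      ← substA_dx, substA_substA hU hV0 hV.mapsTo h', substA_substA hV0 hU h' hV.mapsTo]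
    rfl
  · intro F
    obtain ⟨f, rfl⟩ := Submodule.Quotient.mk_surjective _ F
    exact ⟨Submodule.Quotient.mk (substA hV0 h' f),
      congrArg Submodule.Quotient.mk (substA_substA hU hV0 hV.mapsTo h' f)⟩

/-! ### The leading terms in the variables `δF/δw^0, …, δF/δw^{r-1}, -S(F)` -/

/-- The parameters enter only through ε², so at ε = 0 their reversal plays no role. -/
lemma Dop_zero (a : Fin (r + 1) → ℝ) (k : ℤ) : Dop U 0 a k = Dop U 0 0 k :=
  LinearMap.ext fun F => by simp [Dop_apply]

lemma Dop_zero_apply (k : ℤ) (F : DA U) :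
    Dop U 0 0 k F = 2 * (w U k * dx U F) + dx U (w U k) * F := by
  rw [Dop_apply, two_smul, two_mul]
  simp

lemma geom_zero (F : DA U) : geom U 0 F = F := by
  have := geom_spec 0 F
  rwa [zero_smul, sub_zero] at this

lemma SA_zero (a : Fin (r + 1) → ℝ) (F : DA U) :
    SA 0 a F = (∑ j : Fin r, w U (j : ℤ) * varA j F) - (1 / 2 : ℝ) • WA F := by
  rw [SA_apply]
  simp only [ne_eq, OfNat.ofNat_ne_zero, not_false_eq_true, zero_pow, zero_div, zero_mul,
    geom_zero, zero_smul, sub_zero, smul_sub, ← Finset.smul_sum, smul_smul]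
  norm_num

lemma nlS_zero (a : Fin (r + 1) → ℝ) : nlS (U := U) 0 a = nlS 0 0 := LinearMap.ext fun F => by
  obtain ⟨f, rfl⟩ := Submodule.Quotient.mk_surjective _ F
  exact (SA_zero a f).trans (SA_zero 0 f).symm

/-- The dispersionless covector `δF/δw^0, …, δF/δw^{r-1}`, completed by `-S(F)` in position
`r`. -/
noncomputable def extVar (i : ℕ) : Lam U →ₗ[ℝ] DA U :=
  if h : i < r then var ⟨i, h⟩ else -nlS 0 0

lemma extVar_fin (i : Fin r) : extVar (U := U) i = var i := dif_pos i.2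

lemma extVar_top : extVar (U := U) r = -nlS 0 0 := dif_neg (lt_irrefl r)

/-- This restates 𝒟_r S(F) = ∑_j 𝒟_j(δF/δw^j) as one linear constraint in which the index r is on a
par with the others. -/
lemma sum_Dop_extVar (F : Lam U) :
    ∑ j ∈ Finset.range (r + 1), Dop U 0 0 (j : ℤ) (extVar j F) = 0 := by
  rw [Finset.sum_range_succ, Finset.sum_range, extVar_top, LinearMap.neg_apply, map_neg, Dop_nlS]
  simp only [extVar_fin, add_neg_cancel]

/-- The constants `f_m^{ij}`, for all `i, j ≥ 0`. -/
noncomputable def sgn (m i j : ℕ) : ℝ :=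
  if i < m ∧ j < m then 1 else if m ≤ i ∧ m ≤ j then -1 else 0

/-- `∑_{0 ≤ i, j ≤ r} f_m^{ij} 𝒟_{i+j+1-m}` is the leading term of `P_m` for all `m`. -/
lemma Pform_zero (a : Fin (r + 1) → ℝ) {m : ℕ} (hm : m ≤ r + 2) (F G : Lam U) :
    Pform 0 a m F G = ∑ i ∈ Finset.range (r + 1), ∑ j ∈ Finset.range (r + 1),
      sgn m i j • int U (extVar i F * Dop U 0 0 ((i : ℤ) + j + 1 - m) (extVar j G)) := by
  -- This makes it harmless to let the indices run up to r in the local structures.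
  have hD : ∀ k : ℤ, (r : ℤ) < k → Dop U 0 0 k = 0 := by
    intro k hk
    have hw : w U k = 0 := by
      rw [w, show wSm U k = 0 from Sm.ext fun p => coord_eq_zero _ (.inr hk), map_zero]
    exact LinearMap.ext fun F => by rw [Dop_zero_apply, hw]; simp
  simp only [Finset.sum_range_succ, Finset.sum_range, extVar_fin, extVar_top, LinearMap.neg_apply,
    neg_mul, map_neg, mul_neg, neg_neg, Finset.sum_add_distrib]
  have hS := Dop_nlS 0 0 G
  rcases Nat.lt_or_ge r m with h | h
  · have hs : ∀ i j, i ≤ r → j ≤ r → sgn m i j = 1 := fun i j hi hj => if_pos (by omega)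
    have hs1 : ∀ i j : Fin r, sgn m i j = 1 := fun i j => hs _ _ i.2.le j.2.le
    have hs2 : ∀ i : Fin r, sgn m i r = 1 := fun i => hs _ _ i.2.le le_rfl
    have hs3 : ∀ i : Fin r, sgn m r i = 1 := fun i => hs _ _ le_rfl i.2.le
    simp only [hs1, hs2, hs3, hs r r le_rfl le_rfl, one_smul]
    obtain rfl | rfl : m = r + 1 ∨ m = r + 2 := by omega
    · rw [Pform, if_neg (by omega), if_pos rfl]
      simp only [LinearMap.sub_apply, LinearMap.sum_apply, bra_apply, Dop_zero, nlS_zero a]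
      have e1 : ∀ i j : ℤ, i + j + 1 - ((r + 1 : ℕ) : ℤ) = i + j - r := by
        intro i j; push_cast; ring
      simp only [e1, add_sub_cancel_right, add_sub_cancel_left]
      -- For m = r + 1 the last row and the corner cancel because 𝒟_r S(G) = ∑_j 𝒟_j(δG/δw^j); only
      -- the last column survives, as the nonlocal term. For m = r + 2 all four blocks occur in the
      -- definition as they stand.
      rw [Finset.sum_neg_distrib, Finset.sum_neg_distrib, hS, Finset.mul_sum, map_sum]
      abel
    · rw [Pform, if_neg (by omega), if_neg (by omega), if_pos rfl]
      simp only [LinearMap.sub_apply, LinearMap.add_apply, LinearMap.sum_apply, bra_apply, Dop_zero,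
        nlS_zero a]
      have e1 : ∀ i j : ℤ, i + j + 1 - ((r + 2 : ℕ) : ℤ) = i + j - r - 1 := by
        intro i j; push_cast; ring
      simp only [e1, add_sub_cancel_right, add_sub_cancel_left]
      rw [Finset.sum_neg_distrib, Finset.sum_neg_distrib]
      abel
  · rw [Pform, if_pos h]
    -- For m ≤ r every entry with an index r drops out: if i < m the sign is zero, and if i ≥ m the
    -- operator has index i + r + 1 - m > r.
    have h0 : ∀ (i : Fin r) (X Y : DA U),
        sgn m i r • int U (X * Dop U 0 0 ((i : ℤ) + r + 1 - m) Y) = 0 := by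
      intro i X Y
      by_cases hi : (i : ℕ) < m
      · rw [sgn, if_neg (by omega), if_neg (by omega), zero_smul]
      · rw [hD _ (by omega)]; simp
    have h1 : ∀ (i : Fin r) (X Y : DA U),
        sgn m r i • int U (X * Dop U 0 0 ((r : ℤ) + i + 1 - m) Y) = 0 := by
      intro i X Y
      by_cases hi : (i : ℕ) < m
      · rw [sgn, if_neg (by omega), if_neg (by omega), zero_smul]
      · rw [hD _ (by omega)]; simp
    have h2 : Dop U 0 0 ((r : ℤ) + r + 1 - m) = 0 := hD _ (by omega)
    simp only [smul_neg, h0, h1, h2, LinearMap.zero_apply, mul_zero, map_zero, smul_zero, neg_zero,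
      Finset.sum_const_zero, add_zero, LinearMap.sum_apply, LinearMap.smul_apply, bra_apply,
      Dop_zero a]
    rfl

/-! ### Transformation of the leading terms -/

lemma wSm_top : wSm U (r : ℤ) = 1 := Sm.ext fun _ => coord_top _

lemma pd_wSm_rev (i j : Fin r) :
    pd i (wSm U ((r : ℤ) - j)) = if (i : ℕ) + j = r then 1 else 0 := by
  have hi := i.2
  have hj := j.2
  by_cases h0 : (j : ℕ) = 0
  · rw [h0, Nat.cast_zero, sub_zero, wSm_top, Derivation.map_one_eq_zero, if_neg (by omega)]
  · have h1 : ((r : ℤ) - j) = ((⟨r - j, by omega⟩ : Fin r) : ℤ) := by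
      push_cast [Nat.cast_sub hj.le]; rfl
    rw [h1, pd_wSm]
    refine if_congr ?_ rfl rfl
    rw [Fin.ext_iff]
    simp only
    omega

lemma pd_wSm_zero (i : Fin r) : pd i (wSm U 0) = if (i : ℕ) = 0 then 1 else 0 := by
  have hr := i.pos
  have h := pd_wSm (U := U) i ⟨0, hr⟩
  simp only [Nat.cast_zero, Fin.ext_iff] at h
  exact h

/-- Differentiating w^0 v^j = w^{r-j} and ρ² = w^0 gives ρ² ∂v^j/∂w^i = δ_{i+j,r} - δ_{i,0} v^j and
ρ ∂ρ/∂w^i = ½ δ_{i,0}. The terms with δ_{i,0} combine to -(∑_j v^j δF/δv^j - ½ W̃) = -S̃. -/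
lemma sqrtW_mul_varA_subst (hU : ∀ p ∈ U, 0 < coord p 0)
    (h : Set.MapsTo rev (U : Set (Fin r → ℝ)) V) (i : Fin r) (F : DA V) :
    cst (sqrtW hU).val * varA i (cst (sqrtW hU).val * substA hU h F) =
      (∑ j : Fin r, (if (i : ℕ) + j = r then 1 else 0) * substA hU h (varA j F)) -
        (if (i : ℕ) = 0 then 1 else 0) * substA hU h (SA 0 0 F) := by
  have hv : ∀ j : Fin r, cst (sqrtW hU).val * cst (sqrtW hU).val * cst (pd i (vSm hU j)) =
      (if (i : ℕ) + j = r then 1 else 0) -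
        (if (i : ℕ) = 0 then 1 else 0) * cst (vSm hU j) := by
    intro j
    have h1 := congrArg (pd i) (wSm_zero_mul_pull hU h (j : ℤ))
    rw [Derivation.leibniz, smul_eq_mul, smul_eq_mul, pd_wSm_rev, pd_wSm_zero,
      ← vSm_eq_pull hU h] at h1
    have h2 := congrArg cst (eq_sub_of_add_eq h1)
    rw [← map_mul, ← map_mul, sqrtW_mul_self, h2]
    split_ifs <;> simp
  have hs : cst (sqrtW hU).val * cst (pd i (sqrtW hU).val) =
      (1 / 2 : ℝ) • (if (i : ℕ) = 0 then 1 else 0 : DA U) := by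
    have h1 := congrArg (pd i) (sqrtW_mul_self hU)
    rw [Derivation.leibniz, smul_eq_mul, pd_wSm_zero] at h1
    have h2 := congrArg cst h1
    rw [map_add, map_mul, ← two_smul ℝ] at h2
    have h3 : cst (if (i : ℕ) = 0 then 1 else 0 : Sm U) = if (i : ℕ) = 0 then 1 else 0 := by
      split_ifs <;> simp
    rw [← h3, ← h2, smul_smul]
    norm_num
  rw [varA_subst, mul_add, ← mul_assoc, ← mul_assoc, hs, Finset.mul_sum, SA_zero, map_sub, map_sum,
    map_smul]
  simp only [substA_mul, w, substA_cst, ← vSm_eq_pull hU h, ← mul_assoc, hv, sub_mul,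
    Finset.sum_sub_distrib]
  rw [mul_sub, Finset.mul_sum, smul_mul_assoc, mul_smul_comm]
  simp only [mul_assoc]
  ring

lemma sqrtW_mul_SA_subst (hr : 0 < r) (hU : ∀ p ∈ U, 0 < coord p 0)
    (h : Set.MapsTo rev (U : Set (Fin r → ℝ)) V) (F : DA V) :
    cst (sqrtW hU).val * SA 0 0 (cst (sqrtW hU).val * substA hU h F) =
      -substA hU h (varA ⟨0, hr⟩ F) := by
  have hw : ∀ j : Fin r, cst (wSm U 0) * cst (vSm hU j) = w U (r - j) := fun j => by
    rw [← map_mul, vSm_eq_pull hU h, wSm_zero_mul_pull]; rfl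
  -- As i < r, the pair i = r, j = 0 is missing from i + j = r. Completing the sum costs w^r δF/δv^0
  -- = δF/δv^0, which is the only term left at the end.
  have h1 : ∑ i : Fin r, w U (i : ℤ) *
      ∑ j : Fin r, (if (i : ℕ) + j = r then 1 else 0) * substA hU h (varA j F) =
      (∑ j : Fin r, w U (r - j) * substA hU h (varA j F)) - substA hU h (varA ⟨0, hr⟩ F) := by
    simp only [Finset.mul_sum]
    rw [Finset.sum_comm, eq_sub_iff_add_eq]
    have h2 : substA hU h (varA ⟨0, hr⟩ F) =
        ∑ j : Fin r, (if (j : ℕ) = 0 then 1 else 0) * substA hU h (varA j F) := by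
      rw [Finset.sum_eq_single ⟨0, hr⟩]
      · simp
      · intro j _ hj
        rw [if_neg (fun h => hj (Fin.ext h)), zero_mul]
      · intro h; exact absurd (Finset.mem_univ _) h
    rw [h2, ← Finset.sum_add_distrib]
    refine Finset.sum_congr rfl fun j _ => ?_
    have hj := j.2
    by_cases h0 : (j : ℕ) = 0
    · rw [if_pos h0, h0, Nat.cast_zero, sub_zero, w_top, Finset.sum_eq_zero, zero_add]
      intro i _
      rw [if_neg (by omega), zero_mul, mul_zero]
    · rw [if_neg h0, zero_mul, add_zero, Finset.sum_eq_single ⟨r - j, by omega⟩]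
      · rw [if_pos (by simp only; omega), one_mul, Nat.cast_sub hj.le]
      · intro i _ hi
        rw [if_neg (fun h => hi (Fin.ext (by simp only; omega))), zero_mul, mul_zero]
      · intro h; exact absurd (Finset.mem_univ _) h
  have h3 : ∑ i : Fin r, w U (i : ℤ) *
      ((if (i : ℕ) = 0 then 1 else 0) * substA hU h (SA 0 0 F)) =
      cst (wSm U 0) * substA hU h (SA 0 0 F) := by
    rw [Finset.sum_eq_single ⟨0, hr⟩]
    · simp [w]
    · intro i _ hi
      rw [if_neg (fun h => hi (Fin.ext h)), zero_mul, mul_zero]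
    · intro h; exact absurd (Finset.mem_univ _) h
  rw [SA_zero, mul_sub, Finset.mul_sum]
  simp only [mul_left_comm _ (w U _), sqrtW_mul_varA_subst, mul_sub, Finset.sum_sub_distrib]
  rw [h1, h3, SA_zero, WA_subst, mul_smul_comm, ← mul_assoc, ← map_mul, sqrtW_mul_self, map_sub,
    map_sum, map_smul, mul_sub, Finset.mul_sum, mul_smul_comm]
  have h4 : ∀ j : Fin r, cst (wSm U 0) * substA hU h (w V (j : ℤ) * varA j F) =
      w U (r - j) * substA hU h (varA j F) := fun j => by
    rw [substA_mul, w, substA_cst, ← vSm_eq_pull hU h, ← mul_assoc, hw]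
  simp only [h4]
  ring

/-- With `δF/δw^r := -S(F)`, the transformation of variational derivatives is
`√w^0 δF/δw^i = δF/δv^{r-i}`. -/
lemma sqrtW_mul_extVar (hr : 0 < r) (hU : ∀ p ∈ U, 0 < coord p 0)
    (h : Set.MapsTo rev (U : Set (Fin r → ℝ)) V) {i : ℕ} (hi : i ≤ r) (F : DA V) :
    cst (sqrtW hU).val * extVar i (int U (cst (sqrtW hU).val * substA hU h F)) =
      substA hU h (extVar (r - i) (int V F)) := by
  rcases hi.lt_or_eq with hi | rfl
  · rw [extVar, dif_pos hi]
    refine (sqrtW_mul_varA_subst hU h ⟨i, hi⟩ F).trans ?_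
    simp only
    rcases Nat.eq_zero_or_pos i with rfl | h0
    · rw [Nat.sub_zero, extVar_top, if_pos rfl, Finset.sum_eq_zero]
      · simp only [one_mul, zero_sub, LinearMap.neg_apply, map_neg]
        rfl
      · intro j _
        have := j.2
        rw [if_neg (by omega), zero_mul]
    · rw [extVar, dif_pos (by omega), if_neg h0.ne', zero_mul, sub_zero,
        Finset.sum_eq_single ⟨r - i, by omega⟩]
      · rw [if_pos (by simp only; omega), one_mul]
        rfl
      · intro j _ hj
        rw [if_neg (fun h => hj (Fin.ext (by simp only; omega))), zero_mul]
      · intro h; exact absurd (Finset.mem_univ _) h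
  · rw [Nat.sub_self, extVar_top, extVar, dif_pos hr, LinearMap.neg_apply, mul_neg,
      neg_eq_iff_eq_neg]
    exact sqrtW_mul_SA_subst hr hU h F

/-- Put v = v^{r-l}, X = ρT, Y = ρZ and ∂_y = ρ⁻¹∂_x. Then ρX(2v Y_y + v_y Y) = T(2ρ²v Z_x + (ρ²v)_x
Z), the derivatives of ρ being absorbed into (ρ²v)_x, and ρ²v = w^l. -/
lemma mul_Dop_subst (hU : ∀ p ∈ U, 0 < coord p 0)
    (h : Set.MapsTo rev (U : Set (Fin r → ℝ)) V) (l : ℤ) {X Y : DA V} {T Z : DA U}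
    (hX : cst (sqrtW hU).val * T = substA hU h X) (hY : cst (sqrtW hU).val * Z = substA hU h Y) :
    cst (sqrtW hU).val * substA hU h (X * Dop V 0 0 (r - l) Y) = T * Dop U 0 0 l Z := by
  have hw : cst (sqrtW hU).val * cst (sqrtW hU).val * substA hU h (w V (r - l)) = w U l := by
    rw [← map_mul, sqrtW_mul_self, w, substA_cst, ← map_mul, wSm_zero_mul_pull, sub_sub_cancel]
    rfl
  have hdw := congrArg (dx U) hw
  have h1 := sqrtW_mul_dx_subst hU h (w V (r - l))
  have h2 := sqrtW_mul_dx_subst hU h Y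
  rw [← hY] at h2
  rw [Derivation.leibniz] at h2
  simp only [Derivation.leibniz, smul_eq_mul] at h2 hdw
  rw [substA_mul, Dop_zero_apply, Dop_zero_apply, two_mul, map_add, map_add, substA_mul, substA_mul,
    ← hX, ← hY]
  linear_combination (2 * cst (sqrtW hU).val * T * substA hU h (w V (r - l))) * h2 +
    (cst (sqrtW hU).val * cst (sqrtW hU).val * T * Z) * h1 + (2 * T * dx U Z) * hw + (T * Z) * hdw

/-! ### Cancellation of the signs against the constraint -/

/-- The signs `f_m^{ij} + f_{r+2-m}^{r-i,r-j}` cancel except for `i = m - 1` or `j = m - 1`. -/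
lemma sgn_add_sgn {m i j : ℕ} (hm : m ≤ r + 2) (hi : i ≤ r) (hj : j ≤ r) :
    sgn m i j + sgn (r + 2 - m) (r - i) (r - j) =
      (if i + 1 = m then 1 else 0) + if j + 1 = m then 1 else 0 := by
  have h1 : (r - i < r + 2 - m) ↔ m ≤ i + 1 := by omega
  have h2 : (r - j < r + 2 - m) ↔ m ≤ j + 1 := by omega
  have h3 : (r + 2 - m ≤ r - i) ↔ i + 1 < m := by omega
  have h4 : (r + 2 - m ≤ r - j) ↔ j + 1 < m := by omega
  simp only [sgn, h1, h2, h3, h4]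
  split_ifs <;> first | omega | norm_num

lemma int_mul_Dop_swap (k : ℤ) (X Y : DA U) :
    int U (X * Dop U 0 0 k Y) = -int U (Y * Dop U 0 0 k X) := by
  rw [eq_neg_iff_add_eq_zero, ← map_add, Dop_skew, int_dx]

/-- `∑_{i, j} (f_m^{ij} + f_{r+2-m}^{r-i,r-j}) ∫ θ_i 𝒟_{i+j+1-m} θ'_j = 0` if
`∑_j 𝒟_j θ_j = ∑_j 𝒟_j θ'_j = 0`. -/
lemma sum_sgn_add_sgn {m : ℕ} (hm : m ≤ r + 2) (X Y : ℕ → DA U)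
    (hX : ∑ j ∈ Finset.range (r + 1), Dop U 0 0 (j : ℤ) (X j) = 0)
    (hY : ∑ j ∈ Finset.range (r + 1), Dop U 0 0 (j : ℤ) (Y j) = 0) :
    ∑ i ∈ Finset.range (r + 1), ∑ j ∈ Finset.range (r + 1),
      (sgn m i j + sgn (r + 2 - m) (r - i) (r - j)) •
        int U (X i * Dop U 0 0 ((i : ℤ) + j + 1 - m) (Y j)) = 0 := by
  -- In the row i = m - 1 the index i + j + 1 - m is j, so the row sum pairs X_i with the constraint
  -- on Y.
  have h1 : ∀ (X Y : ℕ → DA U) (i : ℕ),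
      ∑ j ∈ Finset.range (r + 1), Dop U 0 0 (j : ℤ) (Y j) = 0 →
      ∑ j ∈ Finset.range (r + 1), (if i + 1 = m then (1 : ℝ) else 0) •
        int U (X i * Dop U 0 0 ((i : ℤ) + j + 1 - m) (Y j)) = 0 := by
    intro X Y i hY
    rw [← Finset.smul_sum]
    split_ifs with him
    · have e : ∀ j : ℕ, (i : ℤ) + j + 1 - m = j := fun j => by omega
      simp only [e]
      rw [← map_sum, ← Finset.mul_sum, hY, mul_zero, map_zero, smul_zero]
    · exact zero_smul _ _
  -- Skew-adjointness turns the column j = m - 1 into a row with the roles of X and Y exchanged.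
  have h2 : ∀ i ∈ Finset.range (r + 1), ∀ j ∈ Finset.range (r + 1),
      (sgn m i j + sgn (r + 2 - m) (r - i) (r - j)) •
        int U (X i * Dop U 0 0 ((i : ℤ) + j + 1 - m) (Y j)) =
      (if i + 1 = m then (1 : ℝ) else 0) • int U (X i * Dop U 0 0 ((i : ℤ) + j + 1 - m) (Y j)) -
      (if j + 1 = m then (1 : ℝ) else 0) •
        int U (Y j * Dop U 0 0 ((j : ℤ) + i + 1 - m) (X i)) := by
    intro i hi j hj
    rw [sgn_add_sgn hm (by simpa [Nat.lt_succ_iff] using hi) (by simpa [Nat.lt_succ_iff] using hj),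
      add_smul, int_mul_Dop_swap _ (Y j), add_comm (j : ℤ), smul_neg, sub_neg_eq_add]
  rw [Finset.sum_congr rfl fun i hi => Finset.sum_congr rfl (h2 i hi)]
  simp only [Finset.sum_sub_distrib]
  rw [Finset.sum_comm (f := fun i j => (if j + 1 = m then (1 : ℝ) else 0) • _),
    Finset.sum_eq_zero fun i _ => h1 X Y i hY, Finset.sum_eq_zero fun j _ => h1 Y X j hX, sub_zero]

/-! ### Conclusion on local functionals -/

/-- `Λ(V) → Λ(U)`, `∫ f dy ↦ ∫ ρ f dx`: the inverse of `Φ_0` after the identification of local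
functionals in the variables `v` with elements of `Λ_y`. -/
noncomputable def toLamX (hU : ∀ p ∈ U, 0 < coord p 0)
    (h : Set.MapsTo rev (U : Set (Fin r → ℝ)) V) : Lam V →ₗ[ℝ] Lam U :=
  (Phi0 (rho hU)).symm.toLinearMap ∘ₗ toLamY hU h

lemma toLamX_int (hU : ∀ p ∈ U, 0 < coord p 0) (h : Set.MapsTo rev (U : Set (Fin r → ℝ)) V)
    (F : DA V) : toLamX hU h (int V F) = int U (cst (sqrtW hU).val * substA hU h F) := rfl

lemma Pform_toLamX (hr : 0 < r) (hU : ∀ p ∈ U, 0 < coord p 0)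
    (h : Set.MapsTo rev (U : Set (Fin r → ℝ)) V) (a b : Fin (r + 1) → ℝ) {m : ℕ}
    (hm : m ≤ r + 2) (F G : Lam V) :
    Pform 0 a m (toLamX hU h F) (toLamX hU h G) =
      -toLamX hU h (Pform 0 b (r + 2 - m) F G) := by
  obtain ⟨f, rfl⟩ := Submodule.Quotient.mk_surjective _ F
  obtain ⟨g, rfl⟩ := Submodule.Quotient.mk_surjective _ G
  change Pform 0 a m (toLamX hU h (int V f)) (toLamX hU h (int V g)) =
    -toLamX hU h (Pform 0 b (r + 2 - m) (int V f) (int V g))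
  have h1 : toLamX hU h (Pform 0 b (r + 2 - m) (int V f) (int V g)) =
      ∑ i ∈ Finset.range (r + 1), ∑ j ∈ Finset.range (r + 1),
        sgn (r + 2 - m) (r - i) (r - j) • int U (extVar i (toLamX hU h (int V f)) *
          Dop U 0 0 ((i : ℤ) + j + 1 - m) (extVar j (toLamX hU h (int V g)))) := by
    -- Both summation indices are reversed, so that θ̃_{r-i} becomes ρ θ_i.
    rw [Pform_zero b (by omega), map_sum, ← Finset.sum_range_reflect]
    refine Finset.sum_congr rfl fun i hi => ?_
    have hi' : i ≤ r := Nat.lt_succ_iff.1 (Finset.mem_range.1 hi)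
    rw [map_sum, ← Finset.sum_range_reflect]
    refine Finset.sum_congr rfl fun j hj => ?_
    have hj' : j ≤ r := Nat.lt_succ_iff.1 (Finset.mem_range.1 hj)
    have e : ((r - i : ℕ) : ℤ) + (r - j : ℕ) + 1 - (r + 2 - m : ℕ) =
        r - ((i : ℤ) + j + 1 - m) := by omega
    rw [Nat.add_sub_cancel, map_smul, toLamX_int, e, toLamX_int, toLamX_int,
      mul_Dop_subst hU h _ (sqrtW_mul_extVar hr hU h hi' f) (sqrtW_mul_extVar hr hU h hj' g)]
  rw [h1, Pform_zero a hm, eq_neg_iff_add_eq_zero]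
  simp only [← Finset.sum_add_distrib, ← add_smul]
  exact sum_sgn_add_sgn hm _ _ (sum_Dop_extVar _) (sum_Dop_extVar _)

end RKdVCH

theorem mainTheorem9 (r : ℕ) (hr : 0 < r)
    (U V : TopologicalSpace.Opens (Fin r → ℝ)) (hU : ∀ p ∈ U, 0 < RKdVCH.coord p 0)
    (hV : Set.BijOn RKdVCH.rev (U : Set (Fin r → ℝ)) (V : Set (Fin r → ℝ)))
    (a : Fin (r + 1) → ℝ) :
    ∃ hT : Function.Bijective (RKdVCH.toLamY hU hV.mapsTo), ∀ m : ℕ, m ≤ r + 2 →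
      RKdVCH.Phi (RKdVCH.rho hU) 2 (RKdVCH.Plead (U := U) a m) =
        -RKdVCH.push (LinearEquiv.ofBijective (RKdVCH.toLamY hU hV.mapsTo) hT) 2
          (RKdVCH.Plead (U := V) (a ∘ Fin.rev) (r + 2 - m)) := by
  refine ⟨RKdVCH.toLamY_bijective hU hV, fun m hm => AlternatingMap.ext fun Y => ?_⟩
  set T := LinearEquiv.ofBijective (RKdVCH.toLamY hU hV.mapsTo)
    (RKdVCH.toLamY_bijective hU hV) with hT
  -- Both structures live on Λ_y; pulling the arguments back along T to functionals in v reduces the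
  -- equality to `Pform_toLamX`.
  have h1 : ∀ y, (RKdVCH.Phi0 (RKdVCH.rho hU)).symm y =
      RKdVCH.toLamX hU hV.mapsTo (T.symm y) := fun y =>
    congrArg (RKdVCH.Phi0 (RKdVCH.rho hU)).symm (T.apply_symm_apply y).symm
  have h2 : ∀ F, RKdVCH.Phi0 (RKdVCH.rho hU) (RKdVCH.toLamX hU hV.mapsTo F) = T F := fun F =>
    (RKdVCH.Phi0 (RKdVCH.rho hU)).apply_symm_apply _
  change RKdVCH.Phi0 (RKdVCH.rho hU) (RKdVCH.Pform 0 a m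
      ((RKdVCH.Phi0 (RKdVCH.rho hU)).symm (Y 0)) ((RKdVCH.Phi0 (RKdVCH.rho hU)).symm (Y 1))) =
    -T (RKdVCH.Pform 0 (a ∘ Fin.rev) (r + 2 - m) (T.symm (Y 0)) (T.symm (Y 1)))
  rw [h1, h1, RKdVCH.Pform_toLamX hr hU hV.mapsTo a (a ∘ Fin.rev) hm, map_neg, h2]
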